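/- Let $\mathbb R_3$ be the real Clifford algebra with units $e_1,e_2,e_3$ satisfying $e_ie_j+e_je_i=-2\delta_{ij}$, and let $x\mapsto x^c$ be Clifford conjugation (the antiinvolution with $e_i^c=-e_i$). Identify $\mathbb R^4$ with the paravectors $x=x_0+x_1e_1+x_2e_2+x_3e_3$. Let $\mathbb S=\{J\in\mathbb R_3 : J+J^c=0,\ JJ^c=1\}$ and let $\mathcal Q=\{\alpha+\beta J : \alpha,\beta\in\mathbb R,\ J\in\mathbb S\}$ be the quadratic cone. A function $f$ on $\Omega_D=\{\alpha+\beta J : \alpha+i\beta\in D,\ J\in\mathbb S\}$ (with $D\subseteq\mathbb C$ invariant under conjugation) is a slice function if $f(\alpha+\beta J)=F_1(\alpha+i\beta)+JF_2(\alpha+i\beta)$ for some $F_1,F_2:D\to\mathbb R_3$ with $F_1(\bar z)=F_1(z)$, $F_2(\bar z)=-F_2(z)$; it is slice-regular if $D$ is open and $F=F_1+\imath F_2:D\to\mathbb R_3\otimes_{\mathbb R}\mathbb C$ is holomorphic. For a slice-regular $f$, the spherical derivative is $f'_s(x)=\tfrac12\,\mathrm{Im}(x)^{-1}(f(x)-f(x^c))$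 for $x\in\Omega_D\setminus\mathbb R$, where $\mathrm{Im}(x)=(x-x^c)/2$, and it is extended to real points by the slice derivative, i.e. the slice function induced by $\partial F/\partial z$. For an integer $k$, $(x^k)'_s$ denotes the spherical derivative of the power $x\mapsto x^k$, induced by $z\mapsto z^k$ (on $\Omega_{\mathbb C\setminus\{0\}}$ if $k<0$). Let $\overline\partial=\partial_{x_0}+e_1\partial_{x_1}+e_2\partial_{x_2}+e_3\partial_{x_3}$, let $\partial\mathbb B$ be the unit sphere of $\mathbb R^4$, and let $\mathcal Z_k(x,a)$ be the four-dimensional solid zonal harmonic of degree $k$ with pole $a\in\partial\mathbb B$: the homogeneous harmonic polynomial of degree $k$ in $x\in\mathbb R^4$ such that $p(a)=\int_{\partial\mathbb B}p(\zeta)\,\mathcal Z_k(\zeta,a)\,d\sigma(\zeta)$ for every homogeneous harmonic polynomial $p$ of degree $k$, where $\sigma$ is the normalized surface measure. Let $\mathcal K[g](x)=|x|^{-2}g(x/|x|^2)$ be the Kelvin transform in $\mathbb R^4$, and let $C^{(1)}_k$ be the Gegenbauer polynomials. Then for every integer $m\ge1$: (a) For all $x\in\mathbb R^4$, $\mathcal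 Z_{m-1}(x,1)=m\,(x^m)'_s$, and $\overline\partial(x^m)=-\frac2m\,\mathcal Z_{m-1}(x,1)$. (b) The function $\mathcal Z_{m-1}(\cdot,1)$ on $\mathbb R^4$ extends to a slice function on $\mathcal Q$. For all $x\in\mathbb R^4$ and $a\in\partial\mathbb B$, the product $xa^c$ lies in $\mathcal Q$ and, denoting any such extension by the same symbol, $$\mathcal Z_{m-1}(x,a)=\mathcal Z_{m-1}(xa^c,1)=m\,(y^m)'_s\big|_{y=xa^c}=m\sum_{k=0}^{m-1}(xa^c)^{m-k-1}(ax^c)^k .$$ (c) For all $x\in\mathbb R^4\setminus\{0\}$, $(x^{-m})'_s=-\mathcal K\big[(x^m)'_s\big](x)$, and the real components of $(x^{-m})'_s$ are harmonic on $\mathbb R^4\setminus\{0\}$. (d) For all $x\in\partial\mathbb B$, $(x^m)'_s=C^{(1)}_{m-1}(x_0)$, where $x_0$ is the real part of $x$. -/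

import Mathlib

open MeasureTheory

noncomputable section

/-! ### The Clifford algebra `ℝ₃` of signature `(0,3)` and its paravectors -/

/-- The quadratic form `v ↦ -(v₁² + v₂² + v₃²)` on `ℝ³`. -/
def negForm3 : QuadraticForm ℝ (Fin 3 → ℝ) :=
  QuadraticMap.weightedSumSquares ℝ (fun _ : Fin 3 => (-1 : ℝ))

/-- The Clifford algebra `ℝ₃`; its Clifford conjugation `x ↦ x^c` is Mathlib's `star`. -/
abbrev Cl3 : Type := CliffordAlgebra negForm3

/-- The basic unit `e_{i+1}` of `ℝ₃`, for `i = 0, 1, 2`. -/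
def cliffE (i : Fin 3) : Cl3 := CliffordAlgebra.ι negForm3 (Pi.single i 1)

/-- Four-dimensional Euclidean space. -/
abbrev E4 : Type := EuclideanSpace ℝ (Fin 4)

/-- The paravector `x₀ + x₁ e₁ + x₂ e₂ + x₃ e₃` of a point of `ℝ⁴`. -/
def paravector (x : E4) : Cl3 :=
  algebraMap ℝ Cl3 (x 0) + ∑ i : Fin 3, x i.succ • cliffE i

/-- The point `1 ∈ ∂𝔹 ⊂ ℝ⁴`, with paravector `1`. -/
def oneE4 : E4 := EuclideanSpace.single 0 1

/-! ### Slice functions -/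

/-- The sphere of imaginary units: trace `J + J^c = 0` and norm `J J^c = 1`. -/
def imagUnits : Set Cl3 := {J | J + star J = 0 ∧ J * star J = 1}

/-- The circular set `Ω_D`: the points `α + β J` with `α + iβ ∈ D` and `J` an imaginary unit. -/
def circularSet (D : Set ℂ) : Set Cl3 :=
  {x | ∃ z ∈ D, ∃ J ∈ imagUnits, x = algebraMap ℝ Cl3 z.re + z.im • J}

/-- The quadratic cone, the union of all the slices `ℂ_J`. -/
def quadraticCone : Set Cl3 := circularSet Set.univ

/-- The imaginary part `(x - x^c) / 2`. -/
def cliffIm (x : Cl3) : Cl3 := (1 / 2 : ℝ) • (x - star x)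

/-- A slice function on `Ω_D`. The value `F₁(z) + ι F₂(z)` in `ℝ₃ ⊗ ℂ` of the stem function
that induces it is written as the pair `(F₁(z), F₂(z))`.
Only the values of `toFun` on `Ω_D` and those of `stem` on `D` matter. -/
structure SliceFunction (D : Set ℂ) where
  toFun : Cl3 → Cl3
  stem : ℂ → Cl3 × Cl3
  conj_mem : ∀ z ∈ D, (starRingEnd ℂ) z ∈ D
  stem_conj : ∀ z ∈ D, stem ((starRingEnd ℂ) z) = ((stem z).1, -(stem z).2)
  induced : ∀ z ∈ D, ∀ J ∈ imagUnits,
    toFun (algebraMap ℝ Cl3 z.re + z.im • J) = (stem z).1 + J * (stem z).2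

/-- A slice-regular function: the stem function `F` is holomorphic on the open set `D`, with
complex derivative `F' = ∂F/∂z` (called `dstem`); holomorphy is tested on all real components. -/
structure SliceRegular (D : Set ℂ) extends SliceFunction D where
  isOpen_dom : IsOpen D
  dstem : ℂ → Cl3 × Cl3
  holo : ∀ z ∈ D, ∀ φ : Cl3 →ₗ[ℝ] ℝ,
    HasDerivAt (fun w : ℂ => (φ (stem w).1 : ℂ) + (φ (stem w).2 : ℂ) * Complex.I)
      ((φ (dstem z).1 : ℂ) + (φ (dstem z).2 : ℂ) * Complex.I) z

open Classical in
/-- The spherical derivative `f'_s` of a slice-regular function: `½ Im(x)⁻¹ (f(x) - f(x^c))` off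
the real axis, extended by the slice derivative `∂f/∂x` to the real points (where the second
component of the stem function `F'` of `∂f/∂x` vanishes). -/
def SliceRegular.sphericalDeriv {D : Set ℂ} (f : SliceRegular D) (x : Cl3) : Cl3 :=
  if h : ∃ r : ℝ, x = algebraMap ℝ Cl3 r then (f.dstem ((h.choose : ℝ) : ℂ)).1
  else (1 / 2 : ℝ) • (Ring.inverse (cliffIm x) * (f.toFun x - f.toFun (star x)))

theorem imagUnits_sq {J : Cl3} (hJ : J ∈ imagUnits) : J * J = -1 := by
  obtain ⟨h1, h2⟩ := hJ
  rw [eq_neg_of_add_eq_zero_right h1, mul_neg] at h2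
  rw [← h2, neg_neg]

/-- The stem function of a real-coefficient holomorphic function `g`. -/
def realStem (g : ℂ → ℂ) (z : ℂ) : Cl3 × Cl3 :=
  (algebraMap ℝ Cl3 (g z).re, algebraMap ℝ Cl3 (g z).im)

theorem realStem_apply (φ : Cl3 →ₗ[ℝ] ℝ) (g : ℂ → ℂ) (z : ℂ) :
    (φ (realStem g z).1 : ℂ) + (φ (realStem g z).2 : ℂ) * Complex.I = g z * (φ 1 : ℂ) := by
  simp only [realStem, Algebra.algebraMap_eq_smul_one, map_smul, smul_eq_mul]
  conv_rhs => rw [← Complex.re_add_im (g z)]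
  push_cast
  ring

theorem realStem_conj (g : ℂ → ℂ) (z : ℂ)
    (h : g ((starRingEnd ℂ) z) = (starRingEnd ℂ) (g z)) :
    realStem g ((starRingEnd ℂ) z) = ((realStem g z).1, -(realStem g z).2) := by
  simp [realStem, h]

theorem realStem_holo (φ : Cl3 →ₗ[ℝ] ℝ) {g : ℂ → ℂ} {d : ℂ → ℂ} {z : ℂ}
    (h : HasDerivAt g (d z) z) :
    HasDerivAt (fun w : ℂ => (φ (realStem g w).1 : ℂ) + (φ (realStem g w).2 : ℂ) * Complex.I)
      ((φ (realStem d z).1 : ℂ) + (φ (realStem d z).2 : ℂ) * Complex.I) z := by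
  simp only [realStem_apply]
  exact h.mul_const _

theorem realStem_induced {J : Cl3} (hJ : J ∈ imagUnits) (g : ℂ → ℂ) (z : ℂ) :
    Complex.liftAux J (imagUnits_sq hJ) (g z) = (realStem g z).1 + J * (realStem g z).2 := by
  rw [Complex.liftAux_apply, realStem]
  simp [Algebra.algebraMap_eq_smul_one]

/-- The Clifford power `x ↦ x^m`, `m ≥ 0`, induced by `z ↦ z^m`. -/
def cliffPow (m : ℕ) : SliceRegular Set.univ where
  toFun x := x ^ m
  stem := realStem (fun z => z ^ m)
  conj_mem _ _ := Set.mem_univ _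
  stem_conj z _ := realStem_conj _ z (by simp)
  induced z _ J hJ := by
    rw [← realStem_induced hJ, map_pow, Complex.liftAux_apply]
  isOpen_dom := isOpen_univ
  dstem := realStem (fun z => m * z ^ (m - 1))
  holo z _ φ := realStem_holo φ (d := fun z => m * z ^ (m - 1)) (hasDerivAt_pow m z)

/-- The negative Clifford power `x ↦ x^{-m} = (x⁻¹)^m`, induced by `z ↦ z^{-m}` on `ℂ ∖ {0}`. -/
def cliffNegPow (m : ℕ) : SliceRegular ({0}ᶜ : Set ℂ) where
  toFun x := Ring.inverse x ^ m
  stem := realStem (fun z => z ^ (-(m : ℤ)))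
  conj_mem z hz := by simpa using hz
  stem_conj z _ := realStem_conj _ z (by simp)
  induced z hz J hJ := by
    rw [← realStem_induced hJ, ← Complex.liftAux_apply J (imagUnits_sq hJ)]
    have hz' : z ≠ 0 := by simpa using hz
    have h : Ring.inverse (Complex.liftAux J (imagUnits_sq hJ) z)
        = Complex.liftAux J (imagUnits_sq hJ) z⁻¹ := by
      let u : Cl3ˣ := Units.map (Complex.liftAux J (imagUnits_sq hJ) : ℂ →* Cl3)
        (Units.mk0 z hz')
      have hu := Ring.inverse_unit u
      rw [← map_inv] at hu
      exact hu
    rw [h, ← map_pow]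
    simp
  isOpen_dom := isOpen_compl_singleton
  dstem := realStem (fun z => ((-(m : ℤ) : ℤ) : ℂ) * z ^ (-(m : ℤ) - 1))
  holo z hz φ := realStem_holo φ (d := fun z => ((-(m : ℤ) : ℤ) : ℂ) * z ^ (-(m : ℤ) - 1))
    (hasDerivAt_zpow (-(m : ℤ)) z (Or.inl (by simpa using hz)))

/-! ### The Cauchy-Riemann operator, harmonicity and the Kelvin transform on `ℝ⁴` -/

/-- `d` is the partial derivative of `f : ℝ⁴ → ℝ₃` in the coordinate `x_i` at `x`, that is,
componentwise with respect to every real component (linear functional) of `ℝ₃`. -/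
def HasCliffPartial (f : E4 → Cl3) (i : Fin 4) (d : Cl3) (x : E4) : Prop :=
  ∀ φ : Cl3 →ₗ[ℝ] ℝ,
    HasDerivAt (fun t : ℝ => φ (f (x + t • EuclideanSpace.single i (1 : ℝ)))) (φ d) 0

/-- The partial derivatives of `f` exist at `x`, and
`∂̄f(x) = (∂₀ + e₁ ∂₁ + e₂ ∂₂ + e₃ ∂₃) f (x)` equals `v`. -/
def HasCauchyRiemann (f : E4 → Cl3) (v : Cl3) (x : E4) : Prop :=
  ∃ d : Fin 4 → Cl3, (∀ i, HasCliffPartial f i (d i) x) ∧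
    v = d 0 + ∑ i : Fin 3, cliffE i * d i.succ

/-- All the real components of `f : ℝ⁴ → ℝ₃` are harmonic on `s`. -/
def CliffHarmonicOn (f : E4 → Cl3) (s : Set E4) : Prop :=
  ∀ φ : Cl3 →ₗ[ℝ] ℝ, InnerProductSpace.HarmonicOnNhd (fun x => φ (f x)) s

/-- The Kelvin transform in `ℝ⁴`: `𝒦[g](x) = |x|⁻² g(x / |x|²)`. -/
def kelvin (g : E4 → Cl3) (x : E4) : Cl3 := (‖x‖ ^ 2)⁻¹ • g ((‖x‖ ^ 2)⁻¹ • x)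

/-! ### Zonal harmonics -/

/-- `P` is a homogeneous harmonic polynomial of degree `k` on `ℝ⁴`. -/
def IsSolidHarmonic (k : ℕ) (P : MvPolynomial (Fin 4) ℝ) : Prop :=
  P.IsHomogeneous k ∧ ∑ i : Fin 4, MvPolynomial.pderiv i (MvPolynomial.pderiv i P) = 0

/-- The value of a polynomial at a point of `ℝ⁴`. -/
def evalE4 (P : MvPolynomial (Fin 4) ℝ) (x : E4) : ℝ := MvPolynomial.eval (fun i => x i) P

/-- `Z` is the reproducing polynomial at `a ∈ ∂𝔹` of the solid harmonics of degree `k`: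
`p(a) = ∫ p Z dσ` for each of them, with `σ` the normalized surface measure on `∂𝔹`. -/
def IsZonal (k : ℕ) (a : E4) (Z : MvPolynomial (Fin 4) ℝ) : Prop :=
  IsSolidHarmonic k Z ∧ ∀ P, IsSolidHarmonic k P →
    evalE4 P a = ⨍ ζ : Metric.sphere (0 : E4) 1,
      evalE4 P (ζ : E4) * evalE4 Z (ζ : E4) ∂((volume : Measure E4).toSphere)

open Classical in
/-- The four-dimensional solid zonal harmonic `𝒵_k(x, a)` of degree `k` with pole `a ∈ ∂𝔹`. -/
def zonalHarmonic (k : ℕ) (x a : E4) : ℝ :=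
  if h : ∃ Z, IsZonal k a Z then evalE4 h.choose x else 0

/-! ### Gegenbauer polynomials -/

/-- The Gegenbauer polynomials `C_n^{(l)}`, by `C_0 = 1`, `C_1 = 2 l X` and
`(n + 2) C_{n+2} = 2 (n + 1 + l) X C_{n+1} - (n + 2 l) C_n`. -/
def gegenbauer (l : ℝ) : ℕ → Polynomial ℝ
  | 0 => 1
  | 1 => Polynomial.C (2 * l) * Polynomial.X
  | n + 2 => Polynomial.C (2 * ((n : ℝ) + 1 + l) / ((n : ℝ) + 2)) * Polynomial.X
        * gegenbauer l (n + 1)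
      - Polynomial.C (((n : ℝ) + 2 * l) / ((n : ℝ) + 2)) * gegenbauer l n

end

noncomputable section

/-! ### Averages of polynomials over the unit sphere of `ℝ⁴` -/

/-! Everything reduces to one scalar recursion, `chebRec`: s₀ = 0, s₁ = 1, s_{m+2} = t s_{m+1} - n
s_m. Formally s_m = (y^m - c^m)/(y - c) for the roots y, c of X² - tX + n.

On the Clifford side, if y + y^c = t and y y^c = n are real, then y^m - (y^c)^m = s_m (y - y^c) and
∑ y^{m-k-1} (y^c)^k = s_m (`pow_sub_conj_pow`, `sum_pow_mul_conj_pow`), so (y^m)'_s is the real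
number s_m(t, n). A paravector x has t = 2x₀ and n = |x|²; for |a| = 1 the product xa^c has t =
2⟨a,x⟩ and the same n. Inverse powers follow from y⁻¹ = y^c/n and the homogeneity of s_m.

On the harmonic side, 𝒵_{m-1}(x,a) = m s_m(2⟨a,x⟩, |x|²) (`zonalHarmonic_eq`). Write ℓ = ⟨a,·⟩ and
D_a for the derivative along a. Integration by parts against a Gaussian gives (d+3) avg(ℓP) =
avg(D_a P) on the sphere for P homogeneous of degree d (`sphereAvg_X_mul`). For P solid harmonic of
degree k it follows that avg(Pℓ^j) = 0 when j < k, and 2^k (k+1) avg(Pℓ^k) = P(a). On the sphere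
s_{k+1} is a polynomial in ℓ with top term (2ℓ)^k, so (k+1)s_{k+1} reproduces P(a). It is itself
solid harmonic (`polyLaplacian_zonalPoly`), and the symmetry of the reproducing pairing makes it the
only zonal polynomial.

The Cauchy-Riemann formula is an induction on m using x^m = s_{m+1} - s_m x^c. Harmonicity in (c) is
that of P/|x|^{2k+2} for solid harmonic P of degree k. For l = 1 the Gegenbauer recursion is the
recursion of s_m with t = 2x₀, n = 1. -/

theorem integral_volumeIoiPow_eq (n : ℕ) (f : ℝ → ℝ) :
    ∫ r : Set.Ioi (0 : ℝ), f r ∂(Measure.volumeIoiPow n) = ∫ r in Set.Ioi (0 : ℝ), r ^ n * f r := by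
  simp only [Measure.volumeIoiPow, ENNReal.ofReal]
  rw [integral_withDensity_eq_integral_smul
      (measurable_subtype_coe.pow_const _).real_toNNReal,
    integral_subtype_comap measurableSet_Ioi fun a ↦ Real.toNNReal (a ^ n) • f a]
  refine setIntegral_congr_fun measurableSet_Ioi fun x hx ↦ ?_
  simp only [NNReal.smul_def, smul_eq_mul]
  rw [Real.coe_toNNReal _ (pow_nonneg hx.out.le _)]

theorem integrable_volumeIoiPow_iff (n : ℕ) (f : ℝ → ℝ) :
    Integrable (fun r : Set.Ioi (0 : ℝ) => f r) (Measure.volumeIoiPow n) ↔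
      IntegrableOn (fun r => r ^ n * f r) (Set.Ioi (0 : ℝ)) := by
  rw [integrableOn_iff_comap_subtypeVal measurableSet_Ioi, Measure.volumeIoiPow,
    integrable_withDensity_iff_integrable_smul' (by fun_prop) (by simp)]
  refine integrable_congr (.of_forall ?_)
  rintro ⟨x, hx : 0 < x⟩
  simp (disch := positivity) [ENNReal.toReal_ofReal]

/-- The Gaussian moment `∫₀^∞ rⁿ exp(-r²) dr`. -/
def gaussMoment (n : ℕ) : ℝ := ∫ r in Set.Ioi (0 : ℝ), r ^ n * Real.exp (-r ^ 2)

theorem integrableOn_pow_mul_exp_neg_sq (n : ℕ) :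
    IntegrableOn (fun r : ℝ => r ^ n * Real.exp (-r ^ 2)) (Set.Ioi (0 : ℝ)) := by
  have h := integrableOn_rpow_mul_exp_neg_mul_sq one_pos
    (s := (n : ℝ)) (by linarith [n.cast_nonneg (α := ℝ)])
  simpa using h

theorem gaussMoment_eq (n : ℕ) : gaussMoment n = 1 / 2 * Real.Gamma (((n : ℝ) + 1) / 2) := by
  have h := integral_rpow_mul_exp_neg_rpow (p := 2) (q := n) two_pos
    (by linarith [n.cast_nonneg (α := ℝ)])
  rw [← h, gaussMoment]
  simp

theorem gaussMoment_pos (n : ℕ) : 0 < gaussMoment n := by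
  rw [gaussMoment_eq]
  have : 0 < Real.Gamma (((n : ℝ) + 1) / 2) := Real.Gamma_pos_of_pos (by positivity)
  positivity

theorem gaussMoment_add_two (n : ℕ) :
    2 * gaussMoment (n + 2) = ((n : ℝ) + 1) * gaussMoment n := by
  rw [gaussMoment_eq, gaussMoment_eq]
  have : (((n + 2 : ℕ) : ℝ) + 1) / 2 = ((n : ℝ) + 1) / 2 + 1 := by push_cast; ring
  rw [this, Real.Gamma_add_one (by positivity)]
  ring

/-- Polar coordinates: f(rζ) g(r) = r^d f(ζ) g(r) separates, and the volume in dimension 4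
contributes r³ dr. -/
theorem integrable_and_integral_polar {f : E4 → ℝ} {g : ℝ → ℝ} (hf : Continuous f) {d : ℕ}
    (hhom : ∀ (r : ℝ) (x : E4), f (r • x) = r ^ d * f x)
    (hg : IntegrableOn (fun r => r ^ (d + 3) * g r) (Set.Ioi (0 : ℝ))) :
    Integrable (fun x => f x * g ‖x‖) ∧
      ∫ x, f x * g ‖x‖ = (∫ ζ : Metric.sphere (0 : E4) 1, f ζ ∂((volume : Measure E4).toSphere))
        * ∫ r in Set.Ioi (0 : ℝ), r ^ (d + 3) * g r := by
  have hmp := (volume : Measure E4).measurePreserving_homeomorphUnitSphereProd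
  rw [finrank_euclideanSpace_fin] at hmp
  have hemb := (homeomorphUnitSphereProd E4).measurableEmbedding
  let F : Metric.sphere (0 : E4) 1 × Set.Ioi (0 : ℝ) → ℝ :=
    fun p => f p.1 * ((p.2 : ℝ) ^ d * g p.2)
  have hF : ∀ x : ({0}ᶜ : Set E4), F (homeomorphUnitSphereProd E4 x) = f x * g ‖(x : E4)‖ := by
    intro x
    have hx : ‖(x : E4)‖ ≠ 0 := norm_ne_zero_iff.2 x.2
    have h1 : f x = ‖(x : E4)‖ ^ d * f (‖(x : E4)‖⁻¹ • (x : E4)) := by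
      rw [← hhom, smul_smul, mul_inv_cancel₀ hx, one_smul]
    simp only [F, homeomorphUnitSphereProd_apply_snd_coe, homeomorphUnitSphereProd_apply_fst_coe]
    rw [h1]; ring
  have hgi : Integrable (fun r : Set.Ioi (0 : ℝ) => (r : ℝ) ^ d * g r)
      (Measure.volumeIoiPow 3) := by
    rw [integrable_volumeIoiPow_iff 3 (fun r => r ^ d * g r)]
    convert hg using 2
    ring
  have hfi : Integrable (fun ζ : Metric.sphere (0 : E4) 1 => f ζ)
      ((volume : Measure E4).toSphere) :=
    (by fun_prop : Continuous fun ζ : Metric.sphere (0 : E4) 1 => f ζ).integrable_of_hasCompactSupport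
      (HasCompactSupport.of_compactSpace _)
  constructor
  · have h := (hmp.integrable_comp_emb hemb (g := F)).2 (hfi.mul_prod hgi)
    have h2 : Integrable ((fun x => f x * g ‖x‖) ∘ (Subtype.val : ({0}ᶜ : Set E4) → E4))
        (Measure.comap Subtype.val volume) := h.congr (.of_forall hF)
    rw [← integrableOn_iff_comap_subtypeVal (by measurability), IntegrableOn,
      restrict_compl_singleton] at h2
    exact h2
  · have h := hmp.integral_comp hemb F
    simp only [hF] at h
    rw [integral_subtype_comap (measurableSet_singleton _).compl fun x => f x * g ‖x‖,
      restrict_compl_singleton] at h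
    rw [h]
    have h2 := integral_prod_mul (μ := (volume : Measure E4).toSphere)
      (ν := Measure.volumeIoiPow 3) (fun ζ : Metric.sphere (0 : E4) 1 => f ζ)
      (fun r : Set.Ioi (0 : ℝ) => (r : ℝ) ^ d * g r)
    rw [integral_volumeIoiPow_eq 3 (fun r => r ^ d * g r)] at h2
    refine h2.trans ?_
    congr 2
    ext r
    ring

theorem continuous_evalE4 (P : MvPolynomial (Fin 4) ℝ) : Continuous (evalE4 P) :=
  (MvPolynomial.continuous_eval P).comp (by fun_prop)

theorem evalE4_smul_of_isHomogeneous {P : MvPolynomial (Fin 4) ℝ} {d : ℕ} (hP : P.IsHomogeneous d)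
    (r : ℝ) (x : E4) : evalE4 P (r • x) = r ^ d * evalE4 P x := by
  simp only [evalE4, MvPolynomial.eval_eq, Finset.mul_sum]
  refine Finset.sum_congr rfl fun s hs => ?_
  have h : s.degree = d := by
    have : Finsupp.weight (fun _ => 1) s = d := hP (MvPolynomial.mem_support_iff.1 hs)
    rwa [← Finsupp.degree_eq_weight_one] at this
  rw [Finsupp.degree_eq_sum] at h
  simp only [PiLp.smul_apply, smul_eq_mul, mul_pow, Finset.prod_mul_distrib, ← h]
  rw [Finset.prod_pow_eq_pow_sum, Finset.sum_subset (Finset.subset_univ _) (by simp)]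
  ring

theorem hasFDerivAt_evalE4 (P : MvPolynomial (Fin 4) ℝ) (x : E4) :
    HasFDerivAt (evalE4 P) (∑ i : Fin 4, evalE4 (MvPolynomial.pderiv i P) x •
      (EuclideanSpace.proj i : E4 →L[ℝ] ℝ)) x := by
  induction P using MvPolynomial.induction_on with
  | C c =>
    have h : evalE4 (MvPolynomial.C c) = fun _ => c := by ext y; simp [evalE4]
    rw [h]
    exact (hasFDerivAt_const c x).congr_fderiv (by simp [evalE4])
  | add P Q hP hQ =>
    have h : evalE4 (P + Q) = evalE4 P + evalE4 Q := by ext y; simp [evalE4]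
    rw [h]
    exact (hP.add hQ).congr_fderiv (by simp [evalE4, add_smul, Finset.sum_add_distrib])
  | mul_X P i hP =>
    have h : evalE4 (P * MvPolynomial.X i) =
        evalE4 P * (EuclideanSpace.proj i : E4 →L[ℝ] ℝ) := by ext y; simp [evalE4]
    rw [h]
    refine (hP.mul (EuclideanSpace.proj i : E4 →L[ℝ] ℝ).hasFDerivAt).congr_fderiv ?_
    ext v
    simp [evalE4, MvPolynomial.pderiv_X, Pi.single_apply, apply_ite, add_mul, mul_assoc,
      Finset.sum_add_distrib, Finset.mul_sum]

theorem toSphere_real_univ_ne_zero : ((volume : Measure E4).toSphere).real Set.univ ≠ 0 :=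
  have : NeZero ((volume : Measure E4).toSphere) := ⟨Measure.toSphere_ne_zero _⟩
  measureReal_univ_pos.ne'

/-- The average of a polynomial over the unit sphere. -/
def sphereAvg : MvPolynomial (Fin 4) ℝ →ₗ[ℝ] ℝ where
  toFun P := ⨍ ζ : Metric.sphere (0 : E4) 1, evalE4 P ζ ∂((volume : Measure E4).toSphere)
  map_add' P Q := by
    have hi (R : MvPolynomial (Fin 4) ℝ) :
        Integrable (fun ζ : Metric.sphere (0 : E4) 1 => evalE4 R ζ)
          ((volume : Measure E4).toSphere) :=
      ((continuous_evalE4 R).comp continuous_subtype_val).integrable_of_hasCompactSupport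
        (HasCompactSupport.of_compactSpace _)
    simp only [average_eq, ← smul_add]
    rw [← integral_add (hi P) (hi Q)]
    simp [evalE4]
  map_smul' c P := by
    simp [average_eq, evalE4, integral_const_mul]
    ring

theorem sphereAvg_C (c : ℝ) : sphereAvg (MvPolynomial.C c) = c := by
  have : NeZero ((volume : Measure E4).toSphere) := ⟨Measure.toSphere_ne_zero _⟩
  simp [sphereAvg, evalE4]

/-- The integral of a polynomial against the Gaussian weight `exp(-|x|²)`. -/
theorem integral_evalE4_gauss {P : MvPolynomial (Fin 4) ℝ} {d : ℕ} (hP : P.IsHomogeneous d) :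
    Integrable (fun x => evalE4 P x * Real.exp (-‖x‖ ^ 2)) ∧
      ∫ x, evalE4 P x * Real.exp (-‖x‖ ^ 2) =
        ((volume : Measure E4).toSphere).real Set.univ * sphereAvg P * gaussMoment (d + 3) := by
  have h := integrable_and_integral_polar (g := fun r => Real.exp (-r ^ 2))
    (continuous_evalE4 P) (fun r x => evalE4_smul_of_isHomogeneous hP r x)
    (integrableOn_pow_mul_exp_neg_sq (d + 3))
  refine ⟨h.1, h.2.trans ?_⟩
  have hne := toSphere_real_univ_ne_zero
  simp only [sphereAvg, average_eq, gaussMoment, LinearMap.coe_mk, AddHom.coe_mk, smul_eq_mul]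
  rw [mul_inv_cancel_left₀ hne]

theorem evalE4_X_mul (i : Fin 4) (P : MvPolynomial (Fin 4) ℝ) (x : E4) :
    evalE4 (MvPolynomial.X i * P) x = x i * evalE4 P x := by simp [evalE4]

theorem fderiv_exp_neg_norm_sq (x v : E4) :
    DifferentiableAt ℝ (fun y : E4 => Real.exp (-‖y‖ ^ 2)) x ∧
    fderiv ℝ (fun y : E4 => Real.exp (-‖y‖ ^ 2)) x v =
      -(2 * inner ℝ x v * Real.exp (-‖x‖ ^ 2)) := by
  have h : HasFDerivAt (fun y : E4 => Real.exp (-‖y‖ ^ 2)) _ x :=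
    ((hasStrictFDerivAt_norm_sq x).hasFDerivAt.neg).exp
  refine ⟨h.differentiableAt, ?_⟩
  rw [h.fderiv]
  simp
  ring

/-- Integration by parts on the sphere. -/
theorem sphereAvg_X_mul {P : MvPolynomial (Fin 4) ℝ} {d : ℕ} (hP : P.IsHomogeneous d) (i : Fin 4) :
    ((d : ℝ) + 3) * sphereAvg (MvPolynomial.X i * P) = sphereAvg (MvPolynomial.pderiv i P) := by
  have hX := integral_evalE4_gauss ((MvPolynomial.isHomogeneous_X ℝ i).mul hP)
  have hD := integral_evalE4_gauss (hP.pderiv (i := i))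
  have hI := integral_evalE4_gauss hP
  have hd (x : E4) : fderiv ℝ (evalE4 P) x (EuclideanSpace.single i 1) =
      evalE4 (MvPolynomial.pderiv i P) x := by
    rw [(hasFDerivAt_evalE4 P x).fderiv]
    simp
  have hg (x : E4) : evalE4 P x * fderiv ℝ (fun y : E4 => Real.exp (-‖y‖ ^ 2)) x
      (EuclideanSpace.single i 1) =
      (-2) * (evalE4 (MvPolynomial.X i * P) x * Real.exp (-‖x‖ ^ 2)) := by
    rw [(fderiv_exp_neg_norm_sq x _).2, evalE4_X_mul]
    simp [EuclideanSpace.inner_single_right]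
    ring
  have key := integral_mul_fderiv_eq_neg_fderiv_mul_of_integrable (μ := (volume : Measure E4))
    (f := evalE4 P) (g := fun y : E4 => Real.exp (-‖y‖ ^ 2)) (v := EuclideanSpace.single i 1)
    (by simpa only [hd] using hD.1) (by simpa only [hg] using hX.1.const_mul (-2)) hI.1
    (fun x _ => (hasFDerivAt_evalE4 P x).differentiableAt)
    (fun x _ => (fderiv_exp_neg_norm_sq x 0).1)
  simp only [hd, hg] at key
  rw [integral_const_mul, hX.2] at key
  have hne := toSphere_real_univ_ne_zero
  -- For d = 0 the truncated degree d - 1 would give the wrong Gaussian moment. There P is constant,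
  -- both derivative terms vanish, and the integral identity forces the average of xᵢP to be 0.
  rcases d with _ | d
  · have h0 : MvPolynomial.pderiv i P = 0 := by
      rw [← MvPolynomial.totalDegree_zero_iff_isHomogeneous,
        MvPolynomial.totalDegree_eq_zero_iff_eq_C] at hP
      rw [hP, MvPolynomial.pderiv_C]
    have hpos := gaussMoment_pos (1 + 0 + 3)
    have h1 (x : E4) : evalE4 0 x = 0 := by simp [evalE4]
    simp only [h0, h1, zero_mul, integral_zero, neg_zero, mul_eq_zero, hne, hpos.ne', false_or,
      or_false, neg_eq_zero, OfNat.ofNat_ne_zero] at key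
    simp [h0, key]
  rw [hD.2] at key
  have hM := gaussMoment_add_two (d + 3)
  have e1 : 1 + (d + 1) + 3 = d + 3 + 2 := by ring
  rw [e1, Nat.add_sub_cancel] at key
  have hpos := gaussMoment_pos (d + 3)
  apply mul_left_cancel₀ (mul_ne_zero hne hpos.ne')
  push_cast at hM ⊢
  linear_combination (-((volume : Measure E4).toSphere).real Set.univ *
    sphereAvg (MvPolynomial.X i * P)) * hM - key

/-! ### The reproducing property of the zonal polynomials -/

theorem C_two : MvPolynomial.C (2 : ℝ) = (2 : MvPolynomial (Fin 4) ℝ) := map_ofNat _ 2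

theorem pderiv_two (i : Fin 4) : MvPolynomial.pderiv i (2 : MvPolynomial (Fin 4) ℝ) = 0 := by
  rw [← C_two, MvPolynomial.pderiv_C]

/-- The linear form `⟨a, ·⟩`. -/
def linForm (a : E4) : MvPolynomial (Fin 4) ℝ := ∑ i, MvPolynomial.C (a i) * MvPolynomial.X i

/-- The polynomial `|x|²`. -/
def normSqPoly : MvPolynomial (Fin 4) ℝ := ∑ i, MvPolynomial.X i ^ 2

/-- The derivation `∑ aᵢ ∂ᵢ`. -/
def dirDeriv (a : E4) : Derivation ℝ (MvPolynomial (Fin 4) ℝ) (MvPolynomial (Fin 4) ℝ) :=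
  ∑ i, a i • MvPolynomial.pderiv i

/-- The Laplacian of a polynomial. -/
def polyLaplacian (P : MvPolynomial (Fin 4) ℝ) : MvPolynomial (Fin 4) ℝ :=
  ∑ i : Fin 4, MvPolynomial.pderiv i (MvPolynomial.pderiv i P)

theorem dirDeriv_apply (a : E4) (P : MvPolynomial (Fin 4) ℝ) :
    dirDeriv a P = ∑ i, MvPolynomial.C (a i) * MvPolynomial.pderiv i P := by
  simp [dirDeriv, Fin.sum_univ_four, MvPolynomial.smul_eq_C_mul]

theorem pderiv_linForm (a : E4) (i : Fin 4) :
    MvPolynomial.pderiv i (linForm a) = MvPolynomial.C (a i) := by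
  simp [linForm, MvPolynomial.pderiv_X, Pi.single_apply]

theorem pderiv_normSqPoly (i : Fin 4) :
    MvPolynomial.pderiv i normSqPoly = 2 * MvPolynomial.X i := by
  simp [normSqPoly, MvPolynomial.pderiv_X, Pi.single_apply]

theorem evalE4_linForm (a x : E4) : evalE4 (linForm a) x = inner ℝ a x := by
  simp [evalE4, linForm, PiLp.inner_apply, mul_comm]

theorem evalE4_normSqPoly (x : E4) : evalE4 normSqPoly x = ‖x‖ ^ 2 := by
  simp [evalE4, normSqPoly, EuclideanSpace.norm_sq_eq]

theorem dirDeriv_linForm {a : E4} (ha : ‖a‖ = 1) : dirDeriv a (linForm a) = 1 := by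
  have h := EuclideanSpace.norm_sq_eq a
  simp only [ha, Real.norm_eq_abs, sq_abs] at h
  have h2 : dirDeriv a (linForm a) = MvPolynomial.C (∑ i, a i ^ 2) := by
    simp [dirDeriv_apply, pderiv_linForm, sq]
  rw [h2, ← h]; simp

theorem dirDeriv_normSqPoly (a : E4) : dirDeriv a normSqPoly = 2 * linForm a := by
  simp only [dirDeriv_apply, pderiv_normSqPoly, linForm, Finset.mul_sum]
  exact Finset.sum_congr rfl fun i _ => by ring

theorem isHomogeneous_linForm (a : E4) : (linForm a).IsHomogeneous 1 := by
  refine MvPolynomial.IsHomogeneous.sum _ _ _ fun i _ => ?_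
  simpa using (MvPolynomial.isHomogeneous_C (Fin 4) (a i)).mul (MvPolynomial.isHomogeneous_X ℝ i)

theorem isHomogeneous_normSqPoly : normSqPoly.IsHomogeneous 2 :=
  MvPolynomial.IsHomogeneous.sum _ _ _ fun i _ => by
    simpa using (MvPolynomial.isHomogeneous_X ℝ i).pow 2

theorem isHomogeneous_dirDeriv {P : MvPolynomial (Fin 4) ℝ} {d : ℕ} (hP : P.IsHomogeneous d)
    (a : E4) : (dirDeriv a P).IsHomogeneous (d - 1) := by
  rw [dirDeriv_apply]
  refine MvPolynomial.IsHomogeneous.sum _ _ _ fun i _ => ?_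
  simpa using (MvPolynomial.isHomogeneous_C (Fin 4) (a i)).mul (hP.pderiv (i := i))

theorem pderiv_comm (i j : Fin 4) (P : MvPolynomial (Fin 4) ℝ) :
    MvPolynomial.pderiv i (MvPolynomial.pderiv j P) =
      MvPolynomial.pderiv j (MvPolynomial.pderiv i P) := by
  have h : ⁅MvPolynomial.pderiv (R := ℝ) i, MvPolynomial.pderiv j⁆ = 0 :=
    MvPolynomial.derivation_ext fun k => by
      rw [Derivation.commutator_apply]
      simp [MvPolynomial.pderiv_X, Pi.single_apply, apply_ite]
  have h2 := congrArg (fun D => D P) h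
  rw [Derivation.commutator_apply] at h2
  exact sub_eq_zero.1 h2

theorem isSolidHarmonic_dirDeriv {P : MvPolynomial (Fin 4) ℝ} {k : ℕ} (hP : IsSolidHarmonic k P)
    (a : E4) : IsSolidHarmonic (k - 1) (dirDeriv a P) := by
  refine ⟨isHomogeneous_dirDeriv hP.1 a, ?_⟩
  have h (i j : Fin 4) : MvPolynomial.pderiv i (MvPolynomial.pderiv i (MvPolynomial.pderiv j P)) =
      MvPolynomial.pderiv j (MvPolynomial.pderiv i (MvPolynomial.pderiv i P)) := by
    rw [pderiv_comm i j P, pderiv_comm i j]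
  simp only [dirDeriv_apply, map_sum, MvPolynomial.pderiv_C_mul]
  rw [Finset.sum_comm]
  refine Finset.sum_eq_zero fun j _ => ?_
  rw [← Finset.mul_sum, Finset.sum_congr rfl fun i _ => h i j, ← map_sum, hP.2, map_zero, mul_zero]

theorem polyLaplacian_linForm_mul (a : E4) (P : MvPolynomial (Fin 4) ℝ) :
    polyLaplacian (linForm a * P) = linForm a * polyLaplacian P + 2 * dirDeriv a P := by
  simp only [polyLaplacian, dirDeriv_apply, Finset.mul_sum, ← Finset.sum_add_distrib]
  refine Finset.sum_congr rfl fun i _ => ?_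
  simp [pderiv_linForm, Derivation.leibniz]
  ring

theorem polyLaplacian_normSqPoly_mul {P : MvPolynomial (Fin 4) ℝ} {d : ℕ}
    (hP : P.IsHomogeneous d) :
    polyLaplacian (normSqPoly * P) = normSqPoly * polyLaplacian P + (4 * d + 8) * P := by
  have h := hP.sum_X_mul_pderiv
  have h2 (i : Fin 4) : MvPolynomial.pderiv i (MvPolynomial.pderiv i (normSqPoly * P)) =
      normSqPoly * MvPolynomial.pderiv i (MvPolynomial.pderiv i P) +
        4 * (MvPolynomial.X i * MvPolynomial.pderiv i P) + 2 * P := by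
    simp [pderiv_normSqPoly, Derivation.leibniz, pderiv_two]
    ring
  simp only [polyLaplacian, h2, Finset.sum_add_distrib, ← Finset.mul_sum, h]
  simp
  ring

/-! ### Spherical moments of harmonic polynomials against powers of a linear form. -/

theorem sphereAvg_linForm_mul {P : MvPolynomial (Fin 4) ℝ} {d : ℕ} (hP : P.IsHomogeneous d)
    (a : E4) : ((d : ℝ) + 3) * sphereAvg (linForm a * P) = sphereAvg (dirDeriv a P) := by
  simp only [linForm, dirDeriv_apply, Finset.sum_mul, map_sum, Finset.mul_sum,
    MvPolynomial.C_mul', smul_mul_assoc, map_smul, smul_eq_mul]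
  refine Finset.sum_congr rfl fun i _ => ?_
  rw [← sphereAvg_X_mul hP i]
  ring

/-- Integration by parts applied to each ∂ᵢP, together with Euler's identity, gives 0 = avg(ΔP) =
(k+2) k avg(P). -/
theorem sphereAvg_eq_zero_of_isSolidHarmonic {P : MvPolynomial (Fin 4) ℝ} {k : ℕ}
    (hP : IsSolidHarmonic k P) (hk : 0 < k) : sphereAvg P = 0 := by
  have h := congrArg sphereAvg hP.1.sum_X_mul_pderiv
  have h2 := congrArg sphereAvg hP.2
  simp only [map_sum, ← sphereAvg_X_mul (hP.1.pderiv), ← Finset.mul_sum] at h2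
  rw [← map_sum, h, map_nsmul, nsmul_eq_mul, map_zero] at h2
  have : (0 : ℝ) < k := by exact_mod_cast hk
  have h3 : (((k - 1 : ℕ) : ℝ) + 3) * k ≠ 0 := by positivity
  rw [← mul_assoc] at h2
  exact (mul_eq_zero.1 h2).resolve_left h3

theorem sphereAvg_mul_linForm_pow_succ {P : MvPolynomial (Fin 4) ℝ} {k : ℕ}
    (hP : P.IsHomogeneous k) {a : E4} (ha : ‖a‖ = 1) (j : ℕ) :
    ((k : ℝ) + j + 3) * sphereAvg (P * linForm a ^ (j + 1)) =
      sphereAvg (dirDeriv a P * linForm a ^ j) + j * sphereAvg (P * linForm a ^ (j - 1)) := by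
  have h := sphereAvg_linForm_mul (hP.mul ((isHomogeneous_linForm a).pow j)) a
  have e1 : linForm a * (P * linForm a ^ j) = P * linForm a ^ (j + 1) := by ring
  have e2 : dirDeriv a (P * linForm a ^ j) =
      dirDeriv a P * linForm a ^ j + j • (P * linForm a ^ (j - 1)) := by
    rw [Derivation.leibniz, Derivation.leibniz_pow, dirDeriv_linForm ha]
    simp
    ring
  rw [e1, e2, map_add, map_nsmul] at h
  push_cast at h
  simpa using h

/-- Each integration by parts either lowers the degree of P and the exponent by one, keeping P
harmonic, or lowers the exponent by two; the exponent stays below the degree until it reaches 0. -/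
theorem sphereAvg_mul_linForm_pow_of_lt {a : E4} (ha : ‖a‖ = 1) (j : ℕ) :
    ∀ {k : ℕ} {P : MvPolynomial (Fin 4) ℝ}, IsSolidHarmonic k P → j < k →
      sphereAvg (P * linForm a ^ j) = 0 := by
  induction j using Nat.strong_induction_on with
  | _ j ih =>
    intro k P hP hj
    rcases j with _ | j
    · simpa using sphereAvg_eq_zero_of_isSolidHarmonic hP hj
    · have h := sphereAvg_mul_linForm_pow_succ hP.1 ha j
      rw [ih j (by omega) (isSolidHarmonic_dirDeriv hP a) (by omega),
        ih (j - 1) (by omega) hP (by omega)] at h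
      have : (k : ℝ) + j + 3 ≠ 0 := by positivity
      simpa [this] using h

theorem evalE4_dirDeriv_self {P : MvPolynomial (Fin 4) ℝ} {k : ℕ} (hP : P.IsHomogeneous k)
    (a : E4) : evalE4 (dirDeriv a P) a = k * evalE4 P a := by
  have h := congrArg (fun Q => evalE4 Q a) hP.sum_X_mul_pderiv
  simpa [evalE4, dirDeriv_apply] using h

theorem sphereAvg_mul_linForm_pow_self {a : E4} (ha : ‖a‖ = 1) (k : ℕ) :
    ∀ {P : MvPolynomial (Fin 4) ℝ}, IsSolidHarmonic k P →
      2 ^ k * ((k : ℝ) + 1) * sphereAvg (P * linForm a ^ k) = evalE4 P a := by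
  induction k with
  | zero =>
    intro P hP
    have h := hP.1
    rw [← MvPolynomial.totalDegree_zero_iff_isHomogeneous,
      MvPolynomial.totalDegree_eq_zero_iff_eq_C] at h
    rw [h]
    simp [sphereAvg_C, evalE4]
  | succ k ih =>
    intro P hP
    have h := sphereAvg_mul_linForm_pow_succ hP.1 ha k
    have h1 := ih (isSolidHarmonic_dirDeriv hP a)
    -- Only the D_a P term survives; its value at a is (k+1) P(a) by Euler, and the factor k+1+k+3 =
    -- 2(k+2) updates the constant.
    have h2 : (k : ℝ) * sphereAvg (P * linForm a ^ (k - 1)) = 0 := by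
      rw [sphereAvg_mul_linForm_pow_of_lt ha (k - 1) hP (by omega), mul_zero]
    rw [evalE4_dirDeriv_self hP.1] at h1
    rw [h2, add_zero] at h
    rw [← h] at h1
    have : (k : ℝ) + 1 ≠ 0 := by positivity
    apply mul_left_cancel₀ this
    push_cast at h1 ⊢
    rw [← h1]
    ring

/-- The homogeneous Chebyshev recursion `s₀ = 0`, `s₁ = 1`, `s_{m+2} = t s_{m+1} - n s_m`. -/
def chebRec {R : Type*} [Ring R] (t n : R) : ℕ → R
  | 0 => 0
  | 1 => 1
  | m + 2 => t * chebRec t n (m + 1) - n * chebRec t n m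

theorem map_chebRec {R S : Type*} [Ring R] [Ring S] (f : R →+* S) (t n : R) (m : ℕ) :
    f (chebRec t n m) = chebRec (f t) (f n) m := by
  induction m using Nat.twoStepInduction with
  | zero => simp [chebRec]
  | one => simp [chebRec]
  | more m h1 h2 => simp [chebRec, h1, h2]

/-- The zonal polynomial with pole `a`, up to its normalization. -/
def zonalPoly (a : E4) (m : ℕ) : MvPolynomial (Fin 4) ℝ :=
  chebRec (2 * linForm a) normSqPoly m

theorem evalE4_zonalPoly (a x : E4) (m : ℕ) :
    evalE4 (zonalPoly a m) x = chebRec (2 * inner ℝ a x) (‖x‖ ^ 2) m := by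
  rw [← evalE4_linForm, ← evalE4_normSqPoly, evalE4, zonalPoly, map_chebRec]
  simp [evalE4]

theorem zonalPoly_add_two (a : E4) (m : ℕ) :
    zonalPoly a (m + 2) = MvPolynomial.C 2 * (linForm a * zonalPoly a (m + 1)) -
      normSqPoly * zonalPoly a m := by
  rw [C_two, ← mul_assoc]; rfl

theorem isHomogeneous_zonalPoly (a : E4) (m : ℕ) : (zonalPoly a m).IsHomogeneous (m - 1) := by
  induction m using Nat.twoStepInduction with
  | zero => exact MvPolynomial.isHomogeneous_zero _ _ _
  | one => exact MvPolynomial.isHomogeneous_one _ _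
  | more m h1 h2 =>
    rw [zonalPoly_add_two]
    refine MvPolynomial.IsHomogeneous.sub ?_ ?_
    · simpa [add_comm] using (MvPolynomial.isHomogeneous_C (Fin 4) (2 : ℝ)).mul
        ((isHomogeneous_linForm a).mul h2)
    · rcases m with _ | m
      · simpa [zonalPoly, chebRec] using MvPolynomial.isHomogeneous_zero (Fin 4) ℝ 1
      · simpa [add_comm] using isHomogeneous_normSqPoly.mul h1

/-- Moving x along a shifts both roots y, c of X² - 2⟨a,x⟩X + |x|² by the same real number, so y - c
is fixed and y^{m+1} - c^{m+1} differentiates to (m+1)(y^m - c^m). -/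
theorem dirDeriv_zonalPoly {a : E4} (ha : ‖a‖ = 1) (m : ℕ) :
    dirDeriv a (zonalPoly a (m + 1)) = (m + 1) * zonalPoly a m := by
  have h2 : dirDeriv a (2 : MvPolynomial (Fin 4) ℝ) = 0 := (dirDeriv a).map_natCast 2
  induction m using Nat.twoStepInduction with
  | zero => simp [zonalPoly, chebRec]
  | one => simp [zonalPoly, chebRec, dirDeriv_linForm ha, h2]; norm_num
  | more m h0 h1 =>
    have e : zonalPoly a (m + 3) =
        2 * linForm a * zonalPoly a (m + 2) - normSqPoly * zonalPoly a (m + 1) := rfl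
    have e1 : zonalPoly a (m + 2) =
        2 * linForm a * zonalPoly a (m + 1) - normSqPoly * zonalPoly a m := rfl
    rw [e]
    simp only [map_sub, Derivation.leibniz, smul_eq_mul, h0, h1, h2, dirDeriv_linForm ha,
      dirDeriv_normSqPoly]
    rw [show m + 1 + 1 = m + 2 from rfl, e1]
    push_cast
    ring

theorem polyLaplacian_sub (P Q : MvPolynomial (Fin 4) ℝ) :
    polyLaplacian (P - Q) = polyLaplacian P - polyLaplacian Q := by
  simp [polyLaplacian]

theorem polyLaplacian_C_mul (c : ℝ) (P : MvPolynomial (Fin 4) ℝ) :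
    polyLaplacian (MvPolynomial.C c * P) = MvPolynomial.C c * polyLaplacian P := by
  simp [polyLaplacian, MvPolynomial.C_mul', Finset.smul_sum]

/-- The recursion leaves 4 D_a s_{m+1} - (4(m-1)+8) s_m, which cancels because D_a s_{m+1} = (m+1)
s_m. The constant 8 is specific to dimension 4. -/
theorem polyLaplacian_zonalPoly {a : E4} (ha : ‖a‖ = 1) (m : ℕ) :
    polyLaplacian (zonalPoly a m) = 0 := by
  induction m using Nat.twoStepInduction with
  | zero => simp [zonalPoly, chebRec, polyLaplacian]
  | one => simp [zonalPoly, chebRec, polyLaplacian]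
  | more m h0 h1 =>
    rw [zonalPoly_add_two, polyLaplacian_sub, polyLaplacian_C_mul, polyLaplacian_linForm_mul,
      polyLaplacian_normSqPoly_mul (isHomogeneous_zonalPoly a m), h0, h1,
      dirDeriv_zonalPoly ha, C_two]
    rcases m with _ | m
    · simp [zonalPoly, chebRec]
    · push_cast [Nat.add_sub_cancel]
      ring

theorem isSolidHarmonic_zonalPoly {a : E4} (ha : ‖a‖ = 1) (m : ℕ) :
    IsSolidHarmonic (m - 1) (zonalPoly a m) :=
  ⟨isHomogeneous_zonalPoly a m, polyLaplacian_zonalPoly ha m⟩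

theorem sphereAvg_normSqPoly_mul (P : MvPolynomial (Fin 4) ℝ) :
    sphereAvg (normSqPoly * P) = sphereAvg P := by
  have h (ζ : Metric.sphere (0 : E4) 1) : evalE4 (normSqPoly * P) ζ = evalE4 P ζ := by
    have h1 : evalE4 (normSqPoly * P) ζ = evalE4 normSqPoly ζ * evalE4 P ζ := by simp [evalE4]
    rw [h1, evalE4_normSqPoly]
    simp
  simp [sphereAvg, h]

theorem sphereAvg_two_mul (P : MvPolynomial (Fin 4) ℝ) : sphereAvg (2 * P) = 2 * sphereAvg P := by
  rw [← C_two, MvPolynomial.C_mul', map_smul, smul_eq_mul]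

/-- Only the leading term (2ℓ)^m counts: |x|² = 1 on the sphere, so the second term of the recursion
pairs P with a power of ℓ of exponent below k. The exponent i absorbs the factors ℓ released by the
recursion. -/
theorem sphereAvg_mul_linForm_pow_mul_zonalPoly {a : E4} (ha : ‖a‖ = 1) {k : ℕ}
    {P : MvPolynomial (Fin 4) ℝ} (hP : IsSolidHarmonic k P) (m i : ℕ) (hi : i + m ≤ k) :
    sphereAvg (P * linForm a ^ i * zonalPoly a (m + 1)) =
      2 ^ m * sphereAvg (P * linForm a ^ (i + m)) := by
  induction m using Nat.twoStepInduction generalizing i with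
  | zero => simp [zonalPoly, chebRec]
  | one =>
    have e : P * linForm a ^ i * zonalPoly a 2 = 2 * (P * linForm a ^ (i + 1)) := by
      simp [zonalPoly, chebRec]; ring
    rw [e, sphereAvg_two_mul]; simp
  | more m h0 h1 =>
    have e : P * linForm a ^ i * zonalPoly a (m + 3) =
        2 * (P * linForm a ^ (i + 1) * zonalPoly a (m + 2)) -
          normSqPoly * (P * linForm a ^ i * zonalPoly a (m + 1)) := by
      have : zonalPoly a (m + 3) =
        2 * linForm a * zonalPoly a (m + 2) - normSqPoly * zonalPoly a (m + 1) := rfl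
      rw [this]; ring
    rw [e, map_sub, sphereAvg_two_mul, sphereAvg_normSqPoly_mul, h0 i (by omega),
      h1 (i + 1) (by omega), sphereAvg_mul_linForm_pow_of_lt ha (i + m) hP (by omega)]
    rw [show i + 1 + (m + 1) = i + (m + 2) by ring]
    ring

theorem sphereAvg_mul_zonalPoly {a : E4} (ha : ‖a‖ = 1) {k : ℕ}
    {P : MvPolynomial (Fin 4) ℝ} (hP : IsSolidHarmonic k P) :
    ((k : ℝ) + 1) * sphereAvg (P * zonalPoly a (k + 1)) = evalE4 P a := by
  have h := sphereAvg_mul_linForm_pow_mul_zonalPoly ha hP k 0 (by omega)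
  rw [pow_zero, mul_one, zero_add] at h
  rw [h, ← sphereAvg_mul_linForm_pow_self ha k hP]
  ring

theorem isZonal_iff {k : ℕ} {a : E4} {Z : MvPolynomial (Fin 4) ℝ} :
    IsZonal k a Z ↔ IsSolidHarmonic k Z ∧
      ∀ P, IsSolidHarmonic k P → evalE4 P a = sphereAvg (P * Z) := by
  simp [IsZonal, sphereAvg, evalE4]

theorem isZonal_zonalPoly {a : E4} (ha : ‖a‖ = 1) (k : ℕ) :
    IsZonal k a (MvPolynomial.C ((k : ℝ) + 1) * zonalPoly a (k + 1)) := by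
  have h := isSolidHarmonic_zonalPoly ha (k + 1)
  refine isZonal_iff.2 ⟨⟨?_, ?_⟩, fun P hP => ?_⟩
  · simpa using (MvPolynomial.isHomogeneous_C (Fin 4) ((k : ℝ) + 1)).mul h.1
  · change polyLaplacian _ = 0
    rw [polyLaplacian_C_mul, polyLaplacian_zonalPoly ha, mul_zero]
  · rw [mul_left_comm, MvPolynomial.C_mul', map_smul, smul_eq_mul, sphereAvg_mul_zonalPoly ha hP]

theorem chebRec_homogeneous {R : Type*} [CommRing R] (c t n : R) (m : ℕ) :
    chebRec (c * t) (c ^ 2 * n) (m + 1) = c ^ m * chebRec t n (m + 1) := by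
  induction m using Nat.twoStepInduction with
  | zero => simp [chebRec]
  | one => simp [chebRec]
  | more m h0 h1 =>
    have e (t n : R) :
      chebRec t n (m + 3) = t * chebRec t n (m + 2) - n * chebRec t n (m + 1) := rfl
    rw [e, e, h0, h1]
    ring

/-- Uniqueness, needed because `zonalHarmonic` evaluates a chosen polynomial: with Z_b the explicit
zonal polynomial at b = x/|x|, Z(b) = avg(Z Z_b) = Z_b(a), and homogeneity passes from b to x. -/
theorem IsZonal.evalE4_eq {k : ℕ} {a : E4} (ha : ‖a‖ = 1) {Z : MvPolynomial (Fin 4) ℝ}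
    (hZ : IsZonal k a Z) (x : E4) :
    evalE4 Z x = ((k : ℝ) + 1) * chebRec (2 * inner ℝ a x) (‖x‖ ^ 2) (k + 1) := by
  have hZ' := isZonal_iff.1 hZ
  obtain ⟨b, hb, hx⟩ : ∃ b : E4, ‖b‖ = 1 ∧ x = ‖x‖ • b := by
    by_cases h : x = 0
    · exact ⟨a, ha, by simp [h]⟩
    · have h' := norm_ne_zero_iff.2 h
      exact ⟨‖x‖⁻¹ • x, by simp [norm_smul, h'], by simp [smul_smul, h']⟩
  have h1 := (isZonal_iff.1 (isZonal_zonalPoly hb k)).2 Z hZ'.1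
  have h2 := hZ'.2 _ (isZonal_zonalPoly hb k).1
  rw [mul_comm, ← h2] at h1
  have h3 : evalE4 (MvPolynomial.C ((k : ℝ) + 1) * zonalPoly b (k + 1)) a =
      ((k : ℝ) + 1) * evalE4 (zonalPoly b (k + 1)) a := by simp [evalE4]
  rw [h3, evalE4_zonalPoly, ha, real_inner_comm] at h1
  have h4 := chebRec_homogeneous ‖x‖ (2 * inner ℝ a b) (1 ^ 2) k
  calc evalE4 Z x = ‖x‖ ^ k * evalE4 Z b := by
        conv_lhs => rw [hx]
        exact evalE4_smul_of_isHomogeneous hZ'.1.1 _ _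
    _ = ((k : ℝ) + 1) * chebRec (‖x‖ * (2 * inner ℝ a b)) (‖x‖ ^ 2 * 1 ^ 2) (k + 1) := by
        rw [h1, h4]; ring
    _ = _ := by
        have h5 : inner ℝ a x = ‖x‖ * inner ℝ a b := by
          conv_lhs => rw [hx, real_inner_smul_right]
        rw [h5]; congr 2 <;> ring

theorem zonalHarmonic_eq (k : ℕ) (x : E4) {a : E4} (ha : ‖a‖ = 1) :
    zonalHarmonic k x a = ((k : ℝ) + 1) * chebRec (2 * inner ℝ a x) (‖x‖ ^ 2) (k + 1) := by
  have h : ∃ Z, IsZonal k a Z := ⟨_, isZonal_zonalPoly ha k⟩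
  rw [zonalHarmonic, dif_pos h]
  exact h.choose_spec.evalE4_eq ha x

/-! ### Quadratic elements of the Clifford algebra -/

section QuadraticPair

variable {A : Type*} [Ring A] [Algebra ℝ A] {y c : A} {t n : ℝ}

theorem mul_comm_of_add_mul (hadd : y + c = algebraMap ℝ A t) (hmul : y * c = algebraMap ℝ A n) :
    c * y = algebraMap ℝ A n := by
  rw [eq_sub_of_add_eq' hadd, mul_sub, ← Algebra.commutes] at hmul
  rw [eq_sub_of_add_eq' hadd, sub_mul, hmul]

/-- Division of X^m by the quadratic X² - tX + n satisfied by c, with the remainder rewritten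
through y = t - c. -/
theorem conj_pow_eq (hadd : y + c = algebraMap ℝ A t) (hmul : y * c = algebraMap ℝ A n) (m : ℕ) :
    c ^ m = chebRec t n (m + 1) • (1 : A) - chebRec t n m • y := by
  have hc : c = t • (1 : A) - y := by rw [← Algebra.algebraMap_eq_smul_one, ← hadd]; abel
  rw [Algebra.algebraMap_eq_smul_one] at hmul
  induction m with
  | zero => simp [chebRec]
  | succ m ih =>
    have e : chebRec t n (m + 2) = t * chebRec t n (m + 1) - n * chebRec t n m := rfl
    rw [pow_succ, ih, sub_mul, smul_mul_assoc, smul_mul_assoc, one_mul, hmul, e, hc]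
    module

theorem pow_sub_conj_pow (hadd : y + c = algebraMap ℝ A t) (hmul : y * c = algebraMap ℝ A n)
    (m : ℕ) : y ^ m - c ^ m = chebRec t n m • (y - c) := by
  rw [conj_pow_eq hadd hmul, conj_pow_eq ((add_comm _ _).trans hadd) (mul_comm_of_add_mul hadd hmul)]
  module

theorem sum_pow_mul_conj_pow (hadd : y + c = algebraMap ℝ A t) (hmul : y * c = algebraMap ℝ A n)
    (m : ℕ) : ∑ k ∈ Finset.range m, y ^ (m - k - 1) * c ^ k = chebRec t n m • (1 : A) := by
  induction m with
  | zero => simp [chebRec]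
  | succ m ih =>
    have h : ∀ k ∈ Finset.range m, y ^ (m + 1 - k - 1) * c ^ k = y * (y ^ (m - k - 1) * c ^ k) := by
      intro k hk
      have := Finset.mem_range.1 hk
      rw [← mul_assoc, ← pow_succ', show m + 1 - k - 1 = m - k - 1 + 1 by omega]
    rw [Finset.sum_range_succ, Finset.sum_congr rfl h, ← Finset.mul_sum, ih,
      conj_pow_eq hadd hmul]
    simp

end QuadraticPair

/-! ### Spherical derivatives of positive and negative powers. -/

theorem algebraMap_cl3_injective : Function.Injective (algebraMap ℝ Cl3) :=
  (algebraMap ℝ Cl3).injective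

theorem cliffIm_mul_self {y : Cl3} {t n : ℝ} (hadd : y + star y = algebraMap ℝ Cl3 t)
    (hmul : y * star y = algebraMap ℝ Cl3 n) :
    cliffIm y * cliffIm y = algebraMap ℝ Cl3 (t ^ 2 / 4 - n) := by
  have hc : star y = t • (1 : Cl3) - y := by
    rw [← Algebra.algebraMap_eq_smul_one, ← hadd]; abel
  have hyy : y * y = t • y - n • (1 : Cl3) := by
    rw [hc, mul_sub, Algebra.algebraMap_eq_smul_one, mul_smul_comm, mul_one] at hmul
    rw [← hmul]; abel
  rw [cliffIm, hc, Algebra.algebraMap_eq_smul_one]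
  simp only [sub_mul, mul_sub, hyy, smul_mul_assoc, mul_smul_comm, one_mul,
    mul_one]
  module

theorem SliceRegular.sphericalDeriv_of_not_real {D : Set ℂ} (f : SliceRegular D) {y : Cl3}
    (hy : ¬ ∃ r : ℝ, y = algebraMap ℝ Cl3 r) (hu : IsUnit (cliffIm y)) {s : ℝ}
    (hs : f.toFun y - f.toFun (star y) = s • (y - star y)) :
    f.sphericalDeriv y = algebraMap ℝ Cl3 s := by
  rw [sphericalDeriv, dif_neg hy, hs]
  have h : y - star y = (2 : ℝ) • cliffIm y := by rw [cliffIm, smul_smul]; norm_num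
  rw [h, mul_smul_comm, mul_smul_comm, Ring.inverse_mul_cancel _ hu, smul_smul, smul_smul,
    Algebra.algebraMap_eq_smul_one]
  congr 1
  ring

theorem SliceRegular.sphericalDeriv_algebraMap {D : Set ℂ} (f : SliceRegular D) (r : ℝ) :
    f.sphericalDeriv (algebraMap ℝ Cl3 r) = (f.dstem (r : ℂ)).1 := by
  have h : ∃ r' : ℝ, algebraMap ℝ Cl3 r = algebraMap ℝ Cl3 r' := ⟨r, rfl⟩
  rw [sphericalDeriv, dif_pos h, ← algebraMap_cl3_injective h.choose_spec]

theorem isUnit_of_mul_self {y : Cl3} {q : ℝ} (hq : q ≠ 0) (h : y * y = algebraMap ℝ Cl3 q) :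
    IsUnit y := by
  have h1 : y * (q⁻¹ • y) = 1 := by
    rw [mul_smul_comm, h, Algebra.algebraMap_eq_smul_one, smul_smul, inv_mul_cancel₀ hq, one_smul]
  have h2 : (q⁻¹ • y) * y = 1 := by rw [smul_mul_assoc, ← mul_smul_comm, h1]
  exact ⟨⟨y, q⁻¹ • y, h1, h2⟩, rfl⟩

theorem trace_norm_algebraMap {r t n : ℝ}
    (hadd : algebraMap ℝ Cl3 r + star (algebraMap ℝ Cl3 r) = algebraMap ℝ Cl3 t)
    (hmul : algebraMap ℝ Cl3 r * star (algebraMap ℝ Cl3 r) = algebraMap ℝ Cl3 n) :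
    t = 2 * r ∧ n = r ^ 2 := by
  rw [CliffordAlgebra.star_algebraMap] at hadd hmul
  rw [← map_add] at hadd
  rw [← map_mul] at hmul
  have h1 := algebraMap_cl3_injective hadd
  have h2 := algebraMap_cl3_injective hmul
  constructor <;> linarith

theorem chebRec_two_mul_sq (r : ℝ) (m : ℕ) : chebRec (2 * r) (r ^ 2) m = m * r ^ (m - 1) := by
  induction m using Nat.twoStepInduction with
  | zero => simp [chebRec]
  | one => simp [chebRec]
  | more m h0 h1 =>
    rw [chebRec, h0, h1]
    rcases m with _ | m
    · simp
    · push_cast [Nat.add_sub_cancel, show m + 1 + 2 - 1 = m + 2 by omega]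
      ring

/-- Since Im(y)² = t²/4 - n, `hreal` says that y is real whenever this square vanishes; otherwise
Im(y) is invertible. At real r the slice derivative m r^{m-1} equals s_m(2r, r²). -/
theorem sphericalDeriv_cliffPow {y : Cl3} {t n : ℝ} (hadd : y + star y = algebraMap ℝ Cl3 t)
    (hmul : y * star y = algebraMap ℝ Cl3 n)
    (hreal : t ^ 2 / 4 - n = 0 → ∃ r : ℝ, y = algebraMap ℝ Cl3 r) (m : ℕ) :
    (cliffPow m).sphericalDeriv y = algebraMap ℝ Cl3 (chebRec t n m) := by
  by_cases h : ∃ r : ℝ, y = algebraMap ℝ Cl3 r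
  · obtain ⟨r, rfl⟩ := h
    obtain ⟨rfl, rfl⟩ := trace_norm_algebraMap hadd hmul
    rw [SliceRegular.sphericalDeriv_algebraMap, chebRec_two_mul_sq]
    simp only [cliffPow, realStem]
    norm_cast
  · exact (cliffPow m).sphericalDeriv_of_not_real h
      (isUnit_of_mul_self (fun h' => h (hreal h')) (cliffIm_mul_self hadd hmul))
      (pow_sub_conj_pow hadd hmul m)

theorem chebRec_homogeneous' {R : Type*} [CommRing R] (c t n : R) (m : ℕ) :
    c * chebRec (c * t) (c ^ 2 * n) m = c ^ m * chebRec t n m := by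
  rcases m with _ | m
  · simp [chebRec]
  · rw [chebRec_homogeneous]; ring

theorem ring_inverse_eq {y c : Cl3} {t n : ℝ} (hn : n ≠ 0) (hadd : y + c = algebraMap ℝ Cl3 t)
    (hmul : y * c = algebraMap ℝ Cl3 n) : Ring.inverse y = n⁻¹ • c := by
  have hmul' := mul_comm_of_add_mul hadd hmul
  rw [Algebra.algebraMap_eq_smul_one] at hmul hmul'
  let u : Cl3ˣ := ⟨y, n⁻¹ • c,
    by rw [mul_smul_comm, hmul, smul_smul, inv_mul_cancel₀ hn, one_smul],
    by rw [smul_mul_assoc, hmul', smul_smul, inv_mul_cancel₀ hn, one_smul]⟩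
  exact Ring.inverse_unit u

theorem sphericalDeriv_cliffNegPow {y : Cl3} {t n : ℝ} (hn : n ≠ 0)
    (hadd : y + star y = algebraMap ℝ Cl3 t) (hmul : y * star y = algebraMap ℝ Cl3 n)
    (hreal : t ^ 2 / 4 - n = 0 → ∃ r : ℝ, y = algebraMap ℝ Cl3 r) (m : ℕ) :
    (cliffNegPow m).sphericalDeriv y =
      algebraMap ℝ Cl3 (-((n ^ m)⁻¹ * chebRec t n m)) := by
  have hscale : n⁻¹ * chebRec (n⁻¹ * t) n⁻¹ m = (n ^ m)⁻¹ * chebRec t n m := by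
    rw [← inv_pow, ← chebRec_homogeneous', sq, mul_assoc, inv_mul_cancel₀ hn, mul_one]
  by_cases h : ∃ r : ℝ, y = algebraMap ℝ Cl3 r
  · obtain ⟨r, rfl⟩ := h
    obtain ⟨rfl, rfl⟩ := trace_norm_algebraMap hadd hmul
    have hr : r ≠ 0 := fun h => hn (by simp [h])
    rw [SliceRegular.sphericalDeriv_algebraMap, chebRec_two_mul_sq]
    simp only [cliffNegPow, realStem]
    congr 1
    have e : (((-(m : ℤ) : ℤ) : ℂ) * (r : ℂ) ^ (-(m : ℤ) - 1)) =
      (((-(m : ℤ) : ℤ) * r ^ (-(m : ℤ) - 1) : ℝ) : ℂ) := by push_cast; rfl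
    rw [e, Complex.ofReal_re]
    rcases m with _ | m
    · simp
    · have e2 : r ^ (-((m + 1 : ℕ) : ℤ) - 1) = (r ^ (m + 2))⁻¹ := by
        rw [← zpow_natCast, ← zpow_neg]; congr 1
      rw [e2]
      push_cast [Nat.add_sub_cancel]
      field_simp
      ring
  · refine (cliffNegPow m).sphericalDeriv_of_not_real h
      (isUnit_of_mul_self (fun h' => h (hreal h')) (cliffIm_mul_self hadd hmul)) ?_
    -- The inverses of y and y^c are y^c/n and y/n, a pair with trace t/n and norm 1/n. Their
    -- swapped order produces the minus sign.
    have hmul' := mul_comm_of_add_mul hadd hmul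
    have h1 := ring_inverse_eq hn hadd hmul
    have h2 := ring_inverse_eq hn ((add_comm _ _).trans hadd) hmul'
    have hadd2 : n⁻¹ • star y + n⁻¹ • y = algebraMap ℝ Cl3 (n⁻¹ * t) := by
      rw [← smul_add, add_comm, hadd, Algebra.algebraMap_eq_smul_one, smul_smul,
        Algebra.algebraMap_eq_smul_one]
    have hmul2 : n⁻¹ • star y * n⁻¹ • y = algebraMap ℝ Cl3 n⁻¹ := by
      rw [smul_mul_smul_comm, hmul', Algebra.algebraMap_eq_smul_one, smul_smul, mul_assoc,
        inv_mul_cancel₀ hn, mul_one, Algebra.algebraMap_eq_smul_one]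
    simp only [cliffNegPow]
    rw [h1, h2, pow_sub_conj_pow hadd2 hmul2, ← hscale]
    module

/-! ### Paravectors -/

theorem paravector_eq_ι (x : E4) :
    paravector x = algebraMap ℝ Cl3 (x 0) + CliffordAlgebra.ι negForm3 (fun i => x i.succ) := by
  have h : (fun i : Fin 3 => x i.succ) = ∑ i, x i.succ • (Pi.single i 1 : Fin 3 → ℝ) := by
    ext j; simp [Finset.sum_apply, Pi.single_apply]
  rw [h, map_sum, paravector]
  simp [cliffE]

theorem star_paravector_eq_ι (x : E4) : star (paravector x) =
    algebraMap ℝ Cl3 (x 0) - CliffordAlgebra.ι negForm3 (fun i => x i.succ) := by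
  rw [paravector_eq_ι, star_add, CliffordAlgebra.star_algebraMap, CliffordAlgebra.star_ι,
    sub_eq_add_neg]

theorem polar_negForm3 (v w : Fin 3 → ℝ) :
    QuadraticMap.polar negForm3 v w = -2 * ∑ i, v i * w i := by
  simp [QuadraticMap.polar, negForm3, Fin.sum_univ_three]
  ring

theorem paravector_mul_star_add (x a : E4) :
    paravector x * star (paravector a) + paravector a * star (paravector x) =
      algebraMap ℝ Cl3 (2 * inner ℝ a x) := by
  have h := CliffordAlgebra.ι_mul_ι_add_swap (Q := negForm3)
    (fun i => x i.succ) (fun i => a i.succ)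
  have h2 : 2 * inner ℝ a x = 2 * (x 0 * a 0) -
      QuadraticMap.polar negForm3 (fun i => x i.succ) (fun i => a i.succ) := by
    rw [polar_negForm3]
    simp [PiLp.inner_apply, Fin.sum_univ_succ]
    ring
  rw [h2, map_sub, ← h]
  simp only [star_paravector_eq_ι]
  simp only [paravector_eq_ι, Algebra.algebraMap_eq_smul_one, add_mul, mul_sub, smul_mul_assoc,
    mul_smul_comm, one_mul, mul_one]
  module

theorem paravector_mul_star_self (x : E4) :
    paravector x * star (paravector x) = algebraMap ℝ Cl3 (‖x‖ ^ 2) := by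
  have h := paravector_mul_star_add x x
  rw [real_inner_self_eq_norm_sq, ← two_smul ℝ (_ * _), Algebra.algebraMap_eq_smul_one,
    mul_smul] at h
  rw [Algebra.algebraMap_eq_smul_one]
  exact smul_right_injective _ two_ne_zero h

theorem paravector_add_star (x : E4) :
    paravector x + star (paravector x) = algebraMap ℝ Cl3 (2 * x 0) := by
  rw [star_paravector_eq_ι, paravector_eq_ι, Algebra.algebraMap_eq_smul_one,
    Algebra.algebraMap_eq_smul_one]
  module

theorem star_paravector_mul_self (x : E4) :
    star (paravector x) * paravector x = algebraMap ℝ Cl3 (‖x‖ ^ 2) :=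
  mul_comm_of_add_mul (paravector_add_star x) (paravector_mul_star_self x)

theorem paravector_add (x y : E4) : paravector (x + y) = paravector x + paravector y := by
  simp [paravector, add_smul, Finset.sum_add_distrib]
  abel

theorem paravector_smul (r : ℝ) (x : E4) : paravector (r • x) = r • paravector x := by
  simp [paravector, Algebra.algebraMap_eq_smul_one, mul_smul, Finset.smul_sum]

theorem paravector_single_zero : paravector (EuclideanSpace.single 0 1) = 1 := by
  simp [paravector]

theorem paravector_single_succ (i : Fin 3) :
    paravector (EuclideanSpace.single i.succ 1) = cliffE i := by
  simp [paravector]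

theorem paravector_mul_star_trace (x a : E4) :
    paravector x * star (paravector a) + star (paravector x * star (paravector a)) =
      algebraMap ℝ Cl3 (2 * inner ℝ a x) := by
  rw [star_mul, star_star, paravector_mul_star_add]

theorem paravector_mul_star_norm (x : E4) {a : E4} (ha : ‖a‖ = 1) :
    paravector x * star (paravector a) * star (paravector x * star (paravector a)) =
      algebraMap ℝ Cl3 (‖x‖ ^ 2) := by
  rw [star_mul, star_star, mul_assoc, ← mul_assoc (star (paravector a)), star_paravector_mul_self,
    ha, one_pow, map_one, one_mul, paravector_mul_star_self]

/-- Equality in Cauchy-Schwarz: x is a multiple of a, and aa^c = 1. -/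
theorem exists_paravector_mul_star_eq_real {x a : E4} (ha : ‖a‖ = 1)
    (h : (2 * inner ℝ a x) ^ 2 / 4 - ‖x‖ ^ 2 = 0) :
    ∃ r : ℝ, paravector x * star (paravector a) = algebraMap ℝ Cl3 r := by
  have hx : ‖x - (inner ℝ a x : ℝ) • a‖ ^ 2 = 0 := by
    rw [norm_sub_sq_real, real_inner_smul_right, real_inner_comm a x, norm_smul, ha, mul_one,
      Real.norm_eq_abs, sq_abs]
    linarith
  have hx2 : x = (inner ℝ a x : ℝ) • a := by
    rwa [sq_eq_zero_iff, norm_eq_zero, sub_eq_zero] at hx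
  refine ⟨inner ℝ a x, ?_⟩
  conv_lhs => rw [hx2]
  rw [paravector_smul, smul_mul_assoc, paravector_mul_star_self, ha, one_pow, map_one,
    Algebra.algebraMap_eq_smul_one]

theorem sphericalDeriv_cliffPow_mul_star (x : E4) {a : E4} (ha : ‖a‖ = 1) (m : ℕ) :
    (cliffPow m).sphericalDeriv (paravector x * star (paravector a)) =
      algebraMap ℝ Cl3 (chebRec (2 * inner ℝ a x) (‖x‖ ^ 2) m) :=
  sphericalDeriv_cliffPow (paravector_mul_star_trace x a) (paravector_mul_star_norm x ha)
    (exists_paravector_mul_star_eq_real ha) m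

theorem norm_oneE4 : ‖oneE4‖ = 1 := by simp [oneE4]

theorem inner_oneE4 (x : E4) : inner ℝ oneE4 x = x 0 := by
  simp [oneE4, EuclideanSpace.inner_single_left]

theorem exists_paravector_eq_real {x : E4} (h : (2 * x 0) ^ 2 / 4 - ‖x‖ ^ 2 = 0) :
    ∃ r : ℝ, paravector x = algebraMap ℝ Cl3 r := by
  rw [← inner_oneE4] at h
  have := exists_paravector_mul_star_eq_real norm_oneE4 h
  rwa [oneE4, paravector_single_zero, star_one, mul_one] at this

theorem sphericalDeriv_cliffPow_paravector (x : E4) (m : ℕ) :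
    (cliffPow m).sphericalDeriv (paravector x) =
      algebraMap ℝ Cl3 (chebRec (2 * x 0) (‖x‖ ^ 2) m) :=
  sphericalDeriv_cliffPow (paravector_add_star x) (paravector_mul_star_self x)
    exists_paravector_eq_real m

theorem sphericalDeriv_cliffNegPow_paravector {x : E4} (hx : x ≠ 0) (m : ℕ) :
    (cliffNegPow m).sphericalDeriv (paravector x) =
      algebraMap ℝ Cl3 (-(((‖x‖ ^ 2) ^ m)⁻¹ * chebRec (2 * x 0) (‖x‖ ^ 2) m)) :=
  sphericalDeriv_cliffNegPow (pow_ne_zero 2 (norm_ne_zero_iff.2 hx)) (paravector_add_star x)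
    (paravector_mul_star_self x) exists_paravector_eq_real m

theorem sphericalDeriv_cliffNegPow_eq_kelvin {x : E4} (hx : x ≠ 0) (m : ℕ) :
    (cliffNegPow m).sphericalDeriv (paravector x) =
      -kelvin (fun y => (cliffPow m).sphericalDeriv (paravector y)) x := by
  have hn : ‖x‖ ^ 2 ≠ 0 := pow_ne_zero 2 (norm_ne_zero_iff.2 hx)
  have e : ‖(‖x‖ ^ 2)⁻¹ • x‖ ^ 2 = ((‖x‖ ^ 2)⁻¹) ^ 2 * ‖x‖ ^ 2 := by
    rw [norm_smul, mul_pow, Real.norm_eq_abs, sq_abs]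
  rw [sphericalDeriv_cliffNegPow_paravector hx, kelvin, sphericalDeriv_cliffPow_paravector, e,
    ← inv_pow, ← chebRec_homogeneous', map_neg, Algebra.algebraMap_eq_smul_one,
    Algebra.algebraMap_eq_smul_one, smul_smul]
  simp [mul_left_comm]

/-! ### The quadratic cone and slice extensions -/

theorem cliffE_mul_self (i : Fin 3) : cliffE i * cliffE i = -1 := by
  have h : negForm3 (Pi.single i 1) = -1 := by simp [negForm3, Pi.single_apply]
  rw [cliffE, CliffordAlgebra.ι_sq_scalar, h, map_neg, map_one]

theorem cliffE_mul_comm {i j : Fin 3} (h : i ≠ j) : cliffE i * cliffE j = -(cliffE j * cliffE i) := by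
  rw [cliffE, cliffE, eq_neg_iff_add_eq_zero, CliffordAlgebra.ι_mul_ι_add_swap, polar_negForm3]
  simp [Pi.single_apply, h.symm]

theorem star_cliffE (i : Fin 3) : star (cliffE i) = -cliffE i := CliffordAlgebra.star_ι _

theorem cliffE_mem_imagUnits (i : Fin 3) : cliffE i ∈ imagUnits := by
  simp [imagUnits, star_cliffE, cliffE_mul_self]

theorem neg_mem_imagUnits {J : Cl3} (hJ : J ∈ imagUnits) : -J ∈ imagUnits := by
  refine ⟨?_, ?_⟩
  · rw [star_neg, ← neg_add, hJ.1, neg_zero]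
  · rw [star_neg, neg_mul_neg, hJ.2]

theorem slice_trace {J : Cl3} (hJ : J ∈ imagUnits) (α β : ℝ) :
    (algebraMap ℝ Cl3 α + β • J) + star (algebraMap ℝ Cl3 α + β • J) =
      algebraMap ℝ Cl3 (2 * α) := by
  rw [star_add, CliffordAlgebra.star_smul, CliffordAlgebra.star_algebraMap,
    eq_neg_of_add_eq_zero_right hJ.1, Algebra.algebraMap_eq_smul_one,
    Algebra.algebraMap_eq_smul_one]
  module

theorem slice_norm {J : Cl3} (hJ : J ∈ imagUnits) (α β : ℝ) :
    (algebraMap ℝ Cl3 α + β • J) * star (algebraMap ℝ Cl3 α + β • J) =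
      algebraMap ℝ Cl3 (α ^ 2 + β ^ 2) := by
  rw [star_add, CliffordAlgebra.star_smul, CliffordAlgebra.star_algebraMap,
    eq_neg_of_add_eq_zero_right hJ.1, Algebra.algebraMap_eq_smul_one,
    Algebra.algebraMap_eq_smul_one]
  simp only [add_mul, mul_add, smul_mul_assoc, mul_smul_comm, one_mul, mul_one, mul_neg,
    imagUnits_sq hJ]
  module

theorem mem_quadraticCone {y : Cl3} {t n : ℝ} (hadd : y + star y = algebraMap ℝ Cl3 t)
    (hmul : y * star y = algebraMap ℝ Cl3 n) (hle : t ^ 2 / 4 ≤ n)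
    (hreal : t ^ 2 / 4 - n = 0 → ∃ r : ℝ, y = algebraMap ℝ Cl3 r) : y ∈ quadraticCone := by
  by_cases h : t ^ 2 / 4 - n = 0
  · obtain ⟨r, rfl⟩ := hreal h
    exact ⟨(r : ℂ), Set.mem_univ _, cliffE 0, cliffE_mem_imagUnits 0, by simp⟩
  · set β := Real.sqrt (n - t ^ 2 / 4) with hβ
    have hβ2 : β ^ 2 = n - t ^ 2 / 4 := Real.sq_sqrt (by linarith)
    have hβ0 : β ≠ 0 := fun h0 => h (by rw [h0] at hβ2; linarith)
    have hst : star (cliffIm y) = -cliffIm y := by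
      rw [cliffIm, CliffordAlgebra.star_smul, star_sub, star_star, ← smul_neg, neg_sub]
    -- The unit is J = Im(y)/β, with J² = -1 because Im(y)² = t²/4 - n = -β².
    refine ⟨⟨t / 2, β⟩, Set.mem_univ _, β⁻¹ • cliffIm y, ⟨?_, ?_⟩, ?_⟩
    · rw [CliffordAlgebra.star_smul, hst, smul_neg, add_neg_cancel]
    · rw [CliffordAlgebra.star_smul, hst, smul_neg, mul_neg, smul_mul_smul_comm,
        cliffIm_mul_self hadd hmul, Algebra.algebraMap_eq_smul_one, smul_smul, ← neg_smul,
        show t ^ 2 / 4 - n = -β ^ 2 by rw [hβ2]; ring]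
      convert one_smul ℝ (1 : Cl3) using 2
      field_simp
    · simp only
      rw [smul_smul, mul_inv_cancel₀ hβ0, one_smul, cliffIm, eq_sub_of_add_eq' hadd,
        Algebra.algebraMap_eq_smul_one, Algebra.algebraMap_eq_smul_one]
      module

theorem paravector_mul_star_mem_quadraticCone (x : E4) {a : E4} (ha : ‖a‖ = 1) :
    paravector x * star (paravector a) ∈ quadraticCone := by
  refine mem_quadraticCone (paravector_mul_star_trace x a) (paravector_mul_star_norm x ha) ?_
    (exists_paravector_mul_star_eq_real ha)
  have h := abs_real_inner_le_norm a x
  rw [ha, one_mul] at h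
  have h2 := sq_le_sq' (abs_le.1 h).1 (abs_le.1 h).2
  linarith

/-- The slice extension of `𝒵_{m-1}(·, 1)` to the quadratic cone. -/
def zonalSlice (m : ℕ) : SliceFunction Set.univ where
  toFun y := (m : ℝ) • ∑ k ∈ Finset.range m, y ^ (m - k - 1) * star y ^ k
  stem z := (algebraMap ℝ Cl3 (m * chebRec (2 * z.re) (z.re ^ 2 + z.im ^ 2) m), 0)
  conj_mem _ _ := Set.mem_univ _
  stem_conj z _ := by simp
  induced z _ J hJ := by
    rw [sum_pow_mul_conj_pow (slice_trace hJ _ _) (slice_norm hJ _ _), mul_zero, add_zero,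
      smul_smul, Algebra.algebraMap_eq_smul_one]

/-- Independence of the extension: the paravectors α ± βe₁ have the same trace and norm, so g agrees
on them. Hence F₂(z) = 0, and F₁(z) gives the value of g on every slice. -/
theorem SliceFunction.eq_of_eq_on_paravectors (g : SliceFunction Set.univ) {u : ℝ → ℝ → ℝ}
    (hg : ∀ y : E4, g.toFun (paravector y) = algebraMap ℝ Cl3 (u (2 * y 0) (‖y‖ ^ 2)))
    {y : Cl3} (hy : y ∈ quadraticCone) {t n : ℝ} (hadd : y + star y = algebraMap ℝ Cl3 t)
    (hmul : y * star y = algebraMap ℝ Cl3 n) : g.toFun y = algebraMap ℝ Cl3 (u t n) := by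
  obtain ⟨z, hz, J, hJ, rfl⟩ := hy
  have ht := algebraMap_cl3_injective (hadd.symm.trans (slice_trace hJ _ _))
  have hn := algebraMap_cl3_injective (hmul.symm.trans (slice_norm hJ _ _))
  have key (ε : ℝ) (hε : ε ^ 2 = 1) (hJε : ε • cliffE 0 ∈ imagUnits) :
      (g.stem z).1 + (ε • cliffE 0) * (g.stem z).2 = algebraMap ℝ Cl3 (u t n) := by
    rw [← g.induced z hz _ hJε]
    have h := hg (WithLp.toLp 2 ![z.re, z.im * ε, 0, 0])
    have e1 : paravector (WithLp.toLp 2 ![z.re, z.im * ε, 0, 0]) =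
        algebraMap ℝ Cl3 z.re + z.im • ε • cliffE 0 := by
      simp [paravector, Fin.sum_univ_three, mul_smul]
    have e2 : ‖(WithLp.toLp 2 ![z.re, z.im * ε, 0, 0] : E4)‖ ^ 2 = n := by
      rw [EuclideanSpace.norm_sq_eq, hn]
      simp [Fin.sum_univ_four, mul_pow, hε]
    rw [e1, e2] at h
    rw [h, ht]
    simp
  have h1 := key 1 (by norm_num) (by simpa using cliffE_mem_imagUnits 0)
  have h2 := key (-1) (by norm_num) (by simpa using neg_mem_imagUnits (cliffE_mem_imagUnits 0))
  simp only [one_smul, neg_smul, neg_mul] at h1 h2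
  have h3 : (2 : ℝ) • (cliffE 0 * (g.stem z).2) = 0 := by
    rw [two_smul]
    calc _ = ((g.stem z).1 + cliffE 0 * (g.stem z).2)
          - ((g.stem z).1 + -(cliffE 0 * (g.stem z).2)) := by abel
      _ = 0 := by rw [h1, h2, sub_self]
  have h4 : cliffE 0 * (g.stem z).2 = 0 := (smul_eq_zero.1 h3).resolve_left two_ne_zero
  have h5 : (g.stem z).2 = 0 := by
    have := congrArg (cliffE 0 * ·) h4
    simpa [← mul_assoc, cliffE_mul_self] using this
  rw [g.induced z hz J hJ, h5, mul_zero, ← h1, h5, mul_zero]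

/-! ### The Cauchy-Riemann operator on Clifford powers -/

/-- The derivative at `0` of `t ↦ (X + t E) ^ m`. -/
def powDeriv (X E : Cl3) : ℕ → Cl3
  | 0 => 0
  | m + 1 => powDeriv X E m * X + X ^ m * E

/-- Writing (X+tE)^{m+1} = (X+tE)^m X + t (X+tE)^m E, the last factor is absorbed into φ; hence the
induction over all functionals. -/
theorem hasDerivAt_linear_pow (X E : Cl3) (m : ℕ) (φ : Cl3 →ₗ[ℝ] ℝ) :
    HasDerivAt (fun t : ℝ => φ ((X + t • E) ^ m)) (φ (powDeriv X E m)) 0 := by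
  induction m generalizing φ with
  | zero => simpa [powDeriv] using hasDerivAt_const (0 : ℝ) (φ 1)
  | succ m ih =>
    have h1 := ih (φ ∘ₗ LinearMap.mulRight ℝ X)
    have h2 := (hasDerivAt_id (0 : ℝ)).mul (ih (φ ∘ₗ LinearMap.mulRight ℝ E))
    have h3 := h1.add h2
    have e : (fun t : ℝ => φ ((X + t • E) ^ (m + 1))) =
        (fun t => (φ ∘ₗ LinearMap.mulRight ℝ X) ((X + t • E) ^ m)) +
          id * fun t => (φ ∘ₗ LinearMap.mulRight ℝ E) ((X + t • E) ^ m) := by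
      ext t; simp [pow_succ, mul_add]
    rw [e]
    exact h3.congr_deriv (by simp [powDeriv])

theorem hasCliffPartial_pow (x : E4) (m : ℕ) (i : Fin 4) :
    HasCliffPartial (fun y => paravector y ^ m) i
      (powDeriv (paravector x) (paravector (EuclideanSpace.single i 1)) m) x := by
  intro φ
  simp only [paravector_add, paravector_smul]
  exact hasDerivAt_linear_pow _ _ m φ

theorem cliffE_mul_mul_cliffE (i j : Fin 3) :
    cliffE i * cliffE j * cliffE i = if i = j then -cliffE j else cliffE j := by
  split_ifs with h
  · rw [h, cliffE_mul_self, neg_one_mul]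
  · rw [cliffE_mul_comm h, neg_mul, mul_assoc, cliffE_mul_self, mul_neg_one, neg_neg]

theorem add_sum_cliffE_conj_star (x : E4) :
    star (paravector x) + ∑ i, cliffE i * star (paravector x) * cliffE i =
      (-2 : ℝ) • paravector x := by
  have h : star (paravector x) = x 0 • (1 : Cl3) - ∑ i : Fin 3, x i.succ • cliffE i := by
    rw [paravector, star_add, CliffordAlgebra.star_algebraMap, star_sum, sub_eq_add_neg,
      ← Finset.sum_neg_distrib, Algebra.algebraMap_eq_smul_one]
    simp only [CliffordAlgebra.star_smul, star_cliffE, smul_neg]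
  rw [h, paravector, Algebra.algebraMap_eq_smul_one]
  simp only [Fin.sum_univ_three, mul_sub, sub_mul, mul_add, add_mul, mul_smul_comm, smul_mul_assoc,
    mul_one, cliffE_mul_self, cliffE_mul_mul_cliffE]
  simp
  module

/-- The Leibniz rule gives ∂̄(x^{m+1}) = (∂̄x^m) x + (x^m + ∑ eᵢ x^m eᵢ). Substituting x^m = s_{m+1}
- s_m x^c turns the bracket into -2s_{m+1} + 2s_m x, whose second term cancels the inductive one. -/
theorem add_sum_cliffE_powDeriv (x : E4) (m : ℕ) :
    powDeriv (paravector x) 1 m + ∑ i, cliffE i * powDeriv (paravector x) (cliffE i) m =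
      (-2 * chebRec (2 * x 0) (‖x‖ ^ 2) m) • (1 : Cl3) := by
  induction m with
  | zero => simp [powDeriv, chebRec]
  | succ m ih =>
    have hp := conj_pow_eq ((add_comm _ _).trans (paravector_add_star x))
      (star_paravector_mul_self x) m
    have h := add_sum_cliffE_conj_star x
    have h1 : (1 : Cl3) + ∑ i, cliffE i * 1 * cliffE i = (-2 : ℝ) • 1 := by
      simp only [Fin.sum_univ_three, mul_one, cliffE_mul_self]
      module
    have h2 : paravector x ^ m * 1 + ∑ i, cliffE i * (paravector x ^ m * cliffE i) =
        (-2 * chebRec (2 * x 0) (‖x‖ ^ 2) (m + 1)) • (1 : Cl3) +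
          (2 * chebRec (2 * x 0) (‖x‖ ^ 2) m) • paravector x := by
      set s1 := chebRec (2 * x 0) (‖x‖ ^ 2) (m + 1)
      set s0 := chebRec (2 * x 0) (‖x‖ ^ 2) m
      have e : paravector x ^ m * 1 + ∑ i, cliffE i * (paravector x ^ m * cliffE i) =
          s1 • ((1 : Cl3) + ∑ i, cliffE i * 1 * cliffE i) -
            s0 • (star (paravector x) + ∑ i, cliffE i * star (paravector x) * cliffE i) := by
        rw [hp]
        simp only [Fin.sum_univ_three, mul_sub, sub_mul, mul_smul_comm, smul_mul_assoc,
          mul_one, one_mul, ← mul_assoc]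
        module
      rw [e, h1, h]
      module
    have h3 : powDeriv (paravector x) 1 (m + 1) +
        ∑ i, cliffE i * powDeriv (paravector x) (cliffE i) (m + 1) =
        (powDeriv (paravector x) 1 m + ∑ i, cliffE i * powDeriv (paravector x) (cliffE i) m) *
          paravector x +
        (paravector x ^ m * 1 + ∑ i, cliffE i * (paravector x ^ m * cliffE i)) := by
      simp only [powDeriv, mul_add, add_mul, Finset.sum_add_distrib, Finset.sum_mul, mul_assoc]
      abel
    rw [h3, ih, h2, smul_mul_assoc, one_mul]
    module

theorem hasCauchyRiemann_pow (x : E4) (m : ℕ) :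
    HasCauchyRiemann (fun y => paravector y ^ m)
      (algebraMap ℝ Cl3 (-2 * chebRec (2 * x 0) (‖x‖ ^ 2) m)) x := by
  refine ⟨_, hasCliffPartial_pow x m, ?_⟩
  simp only [paravector_single_zero, paravector_single_succ]
  rw [add_sum_cliffE_powDeriv, Algebra.algebraMap_eq_smul_one]

/-! ### Harmonicity of the Kelvin transforms -/

theorem contDiff_evalE4 (P : MvPolynomial (Fin 4) ℝ) : ContDiff ℝ 2 (evalE4 P) := by
  induction P using MvPolynomial.induction_on with
  | C c =>
    have h : evalE4 (MvPolynomial.C c) = fun _ => c := by ext y; simp [evalE4]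
    rw [h]
    exact contDiff_const
  | add P Q hP hQ =>
    have h : evalE4 (P + Q) = evalE4 P + evalE4 Q := by ext y; simp [evalE4]
    rw [h]
    exact hP.add hQ
  | mul_X P i hP =>
    have h : evalE4 (P * MvPolynomial.X i) =
        evalE4 P * (EuclideanSpace.proj i : E4 →L[ℝ] ℝ) := by ext y; simp [evalE4]
    rw [h]
    exact hP.mul (EuclideanSpace.proj i : E4 →L[ℝ] ℝ).contDiff

/-- The function `P(x) / |x|^{2m}`. -/
def divNormPow (P : MvPolynomial (Fin 4) ℝ) (m : ℕ) (x : E4) : ℝ :=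
  evalE4 P x * ((‖x‖ ^ 2) ^ m)⁻¹

theorem contDiffAt_divNormPow (P : MvPolynomial (Fin 4) ℝ) (m : ℕ) {x : E4} (hx : x ≠ 0) :
    ContDiffAt ℝ 2 (divNormPow P m) x :=
  (contDiff_evalE4 P).contDiffAt.mul ((((contDiff_norm_sq ℝ).pow m).contDiffAt).inv
    (pow_ne_zero m (pow_ne_zero 2 (norm_ne_zero_iff.2 hx))))

/-- The numerator of `∂ᵢ (P / |x|^{2(m+1)})` over the denominator `|x|^{2(m+2)}`. -/
def divNormPowNum (P : MvPolynomial (Fin 4) ℝ) (m : ℕ) (i : Fin 4) : MvPolynomial (Fin 4) ℝ :=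
  normSqPoly * MvPolynomial.pderiv i P - MvPolynomial.C (2 * ((m : ℝ) + 1)) * (MvPolynomial.X i * P)

theorem fderiv_divNormPow (P : MvPolynomial (Fin 4) ℝ) (m : ℕ) {x : E4} (hx : x ≠ 0) (i : Fin 4) :
    fderiv ℝ (divNormPow P (m + 1)) x (EuclideanSpace.single i 1) =
      divNormPow (divNormPowNum P m i) (m + 2) x := by
  have hn : ‖x‖ ^ 2 ≠ 0 := pow_ne_zero 2 (norm_ne_zero_iff.2 hx)
  have h1 := ((hasDerivAt_pow (m + 1) (‖x‖ ^ 2)).inv (pow_ne_zero _ hn)).comp_hasFDerivAt x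
    (hasStrictFDerivAt_norm_sq x).hasFDerivAt
  have h2 : HasFDerivAt (divNormPow P (m + 1)) _ x := (hasFDerivAt_evalE4 P x).mul h1
  rw [h2.fderiv]
  have h3 : evalE4 (divNormPowNum P m i) x =
      ‖x‖ ^ 2 * evalE4 (MvPolynomial.pderiv i P) x - 2 * (m + 1) * (x i * evalE4 P x) := by
    rw [← evalE4_normSqPoly]
    simp [evalE4, divNormPowNum]
  rw [divNormPow, h3]
  simp [EuclideanSpace.inner_single_right]
  field_simp
  ring

/-- By ΔP = 0 and Euler's identity the sum is (k+1)|x|²P times -4k - 8 + 4(k+2) = 0. The exponent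
2k+2 is the Kelvin exponent in dimension 4. -/
theorem sum_divNormPowNum {P : MvPolynomial (Fin 4) ℝ} {k : ℕ} (hP : IsSolidHarmonic k P) :
    ∑ i, divNormPowNum (divNormPowNum P k i) (k + 1) i = 0 := by
  have h (i : Fin 4) : divNormPowNum (divNormPowNum P k i) (k + 1) i =
      normSqPoly ^ 2 * MvPolynomial.pderiv i (MvPolynomial.pderiv i P) -
        (4 * (k : MvPolynomial (Fin 4) ℝ) + 4) * normSqPoly *
          (MvPolynomial.X i * MvPolynomial.pderiv i P) -
        (2 * (k : MvPolynomial (Fin 4) ℝ) + 2) * normSqPoly * P +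
        4 * ((k : MvPolynomial (Fin 4) ℝ) + 1) * (k + 2 : MvPolynomial (Fin 4) ℝ) *
          MvPolynomial.X i ^ 2 * P := by
    simp [divNormPowNum, pderiv_normSqPoly, Derivation.leibniz, C_two, pderiv_two]
    ring
  simp only [h, Finset.sum_add_distrib, Finset.sum_sub_distrib, ← Finset.mul_sum, ← Finset.sum_mul,
    hP.1.sum_X_mul_pderiv, hP.2]
  rw [← normSqPoly]
  simp
  ring

theorem harmonicAt_divNormPow {P : MvPolynomial (Fin 4) ℝ} {k : ℕ} (hP : IsSolidHarmonic k P)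
    {x : E4} (hx : x ≠ 0) : InnerProductSpace.HarmonicAt (divNormPow P (k + 1)) x := by
  refine ⟨contDiffAt_divNormPow P _ hx, ?_⟩
  filter_upwards [isOpen_ne.mem_nhds hx] with y hy
  rw [InnerProductSpace.laplacian_eq_iteratedFDeriv_orthonormalBasis _
    (EuclideanSpace.basisFun (Fin 4) ℝ)]
  have hd : DifferentiableAt ℝ (fderiv ℝ (divNormPow P (k + 1))) y :=
    ((contDiffAt_divNormPow P (k + 1) hy).fderiv_right (m := 1) (by norm_num)).differentiableAt
      (by norm_num)
  have h (i : Fin 4) : iteratedFDeriv ℝ 2 (divNormPow P (k + 1)) y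
      ![EuclideanSpace.basisFun (Fin 4) ℝ i, EuclideanSpace.basisFun (Fin 4) ℝ i] =
      divNormPow (divNormPowNum (divNormPowNum P k i) (k + 1) i) (k + 3) y := by
    have h1 : (fun z => fderiv ℝ (divNormPow P (k + 1)) z (EuclideanSpace.single i 1)) =ᶠ[nhds y]
        divNormPow (divNormPowNum P k i) (k + 2) := by
      filter_upwards [isOpen_ne.mem_nhds hy] with z hz
      exact fderiv_divNormPow P k hz i
    rw [← fderiv_divNormPow _ (k + 1) hy, ← h1.fderiv_eq,
      fderiv_clm_apply hd (differentiableAt_const _), iteratedFDeriv_two_apply]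
    simp
  simp only [h, divNormPow, ← Finset.sum_mul, Pi.zero_apply]
  have h2 := congrArg (fun Q => evalE4 Q y) (sum_divNormPowNum hP)
  simp only [evalE4, map_sum, map_zero] at h2
  simp only [evalE4]
  rw [h2, zero_mul]

theorem cliffHarmonicOn_cliffNegPow (k : ℕ) :
    CliffHarmonicOn (fun x => (cliffNegPow (k + 1)).sphericalDeriv (paravector x)) {0}ᶜ := by
  intro φ x hx
  have h := (harmonicAt_divNormPow (isSolidHarmonic_zonalPoly norm_oneE4 (k + 1)) hx).const_smul
    (c := -φ 1)
  refine (InnerProductSpace.harmonicAt_congr_nhds ?_).1 h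
  filter_upwards [isOpen_ne.mem_nhds hx] with y hy
  rw [sphericalDeriv_cliffNegPow_paravector hy, Algebra.algebraMap_eq_smul_one, map_smul]
  simp [divNormPow, evalE4_zonalPoly, inner_oneE4]
  ring

/-! ### Gegenbauer polynomials and the main theorem -/

theorem gegenbauer_one_eval (k : ℕ) (r : ℝ) :
    (gegenbauer 1 k).eval r = chebRec (2 * r) 1 (k + 1) := by
  induction k using Nat.twoStepInduction with
  | zero => simp [gegenbauer, chebRec]
  | one => simp [gegenbauer, chebRec]
  | more k h0 h1 =>
    have e : chebRec (2 * r) 1 (k + 3) =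
      2 * r * chebRec (2 * r) 1 (k + 2) - 1 * chebRec (2 * r) 1 (k + 1) := rfl
    have hk : (k : ℝ) + 2 ≠ 0 := by positivity
    rw [gegenbauer, e, ← h0, ← h1]
    simp only [Polynomial.eval_sub, Polynomial.eval_mul, Polynomial.eval_C, Polynomial.eval_X]
    field_simp
    ring

end

theorem mainTheorem10 (m : ℕ) (hm : 1 ≤ m) :
    -- (a)
    (∀ x : E4,
      algebraMap ℝ Cl3 (zonalHarmonic (m - 1) x oneE4)
          = (m : ℝ) • (cliffPow m).sphericalDeriv (paravector x) ∧
      HasCauchyRiemann (fun y => paravector y ^ m)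
        (algebraMap ℝ Cl3 (-(2 / (m : ℝ)) * zonalHarmonic (m - 1) x oneE4)) x) ∧
    -- (b), where `g` is the extension of `𝒵_{m-1}(·, 1)` to a slice function on the cone
    (∃ g : SliceFunction Set.univ,
      ∀ y : E4, g.toFun (paravector y) = algebraMap ℝ Cl3 (zonalHarmonic (m - 1) y oneE4)) ∧
    (∀ x a : E4, ‖a‖ = 1 →
      paravector x * star (paravector a) ∈ quadraticCone ∧
      (∀ g : SliceFunction Set.univ,
        (∀ y : E4,
          g.toFun (paravector y) = algebraMap ℝ Cl3 (zonalHarmonic (m - 1) y oneE4)) →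
        algebraMap ℝ Cl3 (zonalHarmonic (m - 1) x a)
          = g.toFun (paravector x * star (paravector a))) ∧
      algebraMap ℝ Cl3 (zonalHarmonic (m - 1) x a)
        = (m : ℝ) • (cliffPow m).sphericalDeriv (paravector x * star (paravector a)) ∧
      algebraMap ℝ Cl3 (zonalHarmonic (m - 1) x a)
        = (m : ℝ) • ∑ k ∈ Finset.range m,
            (paravector x * star (paravector a)) ^ (m - k - 1)
              * (paravector a * star (paravector x)) ^ k) ∧
    -- (c)
    (∀ x : E4, x ≠ 0 →
      (cliffNegPow m).sphericalDeriv (paravector x)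
        = -kelvin (fun y => (cliffPow m).sphericalDeriv (paravector y)) x) ∧
    CliffHarmonicOn (fun x => (cliffNegPow m).sphericalDeriv (paravector x)) {0}ᶜ ∧
    -- (d)
    (∀ x : E4, ‖x‖ = 1 →
      (cliffPow m).sphericalDeriv (paravector x)
        = algebraMap ℝ Cl3 ((gegenbauer 1 (m - 1)).eval (x 0))) := by
  obtain ⟨k, rfl⟩ : ∃ k, m = k + 1 := ⟨m - 1, by omega⟩
  have hZ (x a : E4) (ha : ‖a‖ = 1) : zonalHarmonic (k + 1 - 1) x a =
      ((k + 1 : ℕ) : ℝ) * chebRec (2 * inner ℝ a x) (‖x‖ ^ 2) (k + 1) := by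
    rw [Nat.add_sub_cancel, zonalHarmonic_eq k x ha]
    push_cast
    rfl
  have hZ1 (x : E4) : zonalHarmonic (k + 1 - 1) x oneE4 =
      ((k + 1 : ℕ) : ℝ) * chebRec (2 * x 0) (‖x‖ ^ 2) (k + 1) := by
    rw [hZ x oneE4 norm_oneE4, inner_oneE4]
  have hmap (c s : ℝ) : algebraMap ℝ Cl3 (c * s) = c • algebraMap ℝ Cl3 s := by
    rw [map_mul, Algebra.smul_def]
  refine ⟨fun x => ⟨?_, ?_⟩, ⟨zonalSlice (k + 1), fun y => ?_⟩, fun x a ha => ⟨?_, ?_, ?_, ?_⟩,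
    fun x hx => sphericalDeriv_cliffNegPow_eq_kelvin hx _, cliffHarmonicOn_cliffNegPow k,
    fun x hx => ?_⟩
  · rw [hZ1, sphericalDeriv_cliffPow_paravector, hmap]
  · convert hasCauchyRiemann_pow x (k + 1) using 2
    rw [hZ1]
    field_simp
  · rw [hZ1, hmap, Algebra.algebraMap_eq_smul_one, zonalSlice]
    simp only
    rw [sum_pow_mul_conj_pow (paravector_add_star y) (paravector_mul_star_self y)]
  · exact paravector_mul_star_mem_quadraticCone x ha
  · intro g hg
    rw [hZ x a ha]
    symm
    -- On paravectors t = 2y₀ and n = |y|²; at xa^c the same function u is read at t = 2⟨a,x⟩, n =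
    -- |x|².
    exact g.eq_of_eq_on_paravectors
      (u := fun t n => ((k + 1 : ℕ) : ℝ) * chebRec t n (k + 1)) (fun y => by rw [hg y, hZ1])
      (paravector_mul_star_mem_quadraticCone x ha) (paravector_mul_star_trace x a)
      (paravector_mul_star_norm x ha)
  · rw [hZ x a ha, hmap, sphericalDeriv_cliffPow_mul_star x ha]
  · have hs : paravector a * star (paravector x) = star (paravector x * star (paravector a)) := by
      rw [star_mul, star_star]
    rw [hZ x a ha, hs, sum_pow_mul_conj_pow (paravector_mul_star_trace x a)
      (paravector_mul_star_norm x ha), hmap, Algebra.algebraMap_eq_smul_one]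
  · rw [sphericalDeriv_cliffPow_paravector, hx, one_pow, Nat.add_sub_cancel, gegenbauer_one_eval]
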